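/- A run-length straight-line program (RLSLP) is a context-free grammar whose variables are linearly ordered, whose greatest variable is the start variable, and in which each variable $A$ has exactly one rule, of one of the forms $A \to a$ ($a$ a terminal), $A \to A_1 \cdots A_k$ with $k>1$, or $A \to B^t$ with $t>2$, where all variables on the right-hand side are smaller than $A$; thus it generates exactly one string. These rules have sizes $1$, $k$ and $2$, respectively, and the size of an RLSLP is the sum of the sizes of its rules. For a nonempty string $w[1:n]$ over an ordered alphabet, let $g_{rl}$ be the size of the smallest RLSLP generating $w$. Theorem. For every nonempty string $w[1:n]$ over an ordered alphabet there is an index of size $O(g_{rl})$ that supports range minimum queries on $w$ in $O(\log n)$ time: given $1 \le i \le j \le n$, it returns the position of the leftmost occurrence of the minimum symbol of $w[i:j]$. Here size and time are measured on a word RAM with words of at least $\log_2 n + O(1)$ bits: the index occupies $O(g_{rl})$ words, and one fixed query program answers each query on the index of any string in $O(1+\log n)$ steps. The query program uses no memory other than that of the index, which it leaves unchanged, and $O(1)$ registers. The program and the constants hidden in the $O$-notation do not depend on the string or the alphabet. -/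

import Mathlib

/-! ### Run-length straight-line programs -/

/-- Right-hand sides of the rules of a run-length straight-line program with terminals in `α`
and variables in `V`. -/
inductive RLRule (α : Type*) (V : Type*) where
  /-- `A → a` for a terminal symbol `a` -/
  | terminal (a : α)
  /-- `A → A₁ A₂ ⋯ A_k` for variables `A₁, …, A_k` -/
  | concat (l : List V)
  /-- `A → B ^ t` for a variable `B` -/
  | power (B : V) (t : ℕ)

/-- The size of a rule is the length of its right-hand side; a run-length rule has size 2. -/
def RLRule.size {α V : Type*} : RLRule α V → ℕ
  | .terminal _ => 1
  | .concat l => l.length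
  | .power _ _ => 2

/-- A run-length straight-line program: the variables are `0 < 1 < ⋯ < top`, each has exactly one
rule, a rule refers only to strictly smaller variables, a concatenation has more than one factor,
and a run-length rule has an exponent greater than 2. The start variable is the greatest one. -/
structure RLSLP (α : Type*) where
  top : ℕ
  rule : Fin (top + 1) → RLRule α (Fin (top + 1))
  concat_length : ∀ A l, rule A = .concat l → 1 < l.length
  concat_lt : ∀ A l, rule A = .concat l → ∀ B ∈ l, B < A
  power_exponent : ∀ A B t, rule A = .power B t → 2 < t
  power_lt : ∀ A B t, rule A = .power B t → B < A

namespace RLSLP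

variable {α : Type*}

/-- The string `exp(A)` derived from the variable `A`. -/
def expand (G : RLSLP α) (A : Fin (G.top + 1)) : List α :=
  match h : G.rule A with
  | .terminal a => [a]
  | .concat l => (l.attach.map fun B => G.expand B.1).flatten
  | .power B t => (List.replicate t (G.expand B)).flatten
termination_by A
decreasing_by
  · exact G.concat_lt A l h B.1 B.2
  · exact G.power_lt A B t h

/-- The string generated by the program. -/
def generated (G : RLSLP α) : List α := G.expand (Fin.last G.top)

/-- The size of the program: the sum of the sizes of its rules. -/
def size (G : RLSLP α) : ℕ := ∑ A, (G.rule A).size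

end RLSLP

/-- `g_rl(w)`, the size of the smallest run-length straight-line program generating `w`
(for a nonempty string `w`; no such program generates the empty string). -/
noncomputable def grl {α : Type*} (w : List α) : ℕ :=
  sInf {s | ∃ G : RLSLP α, G.generated = w ∧ G.size = s}

/-! ### Range minimum queries -/

/-- `k` is the position of the leftmost occurrence of the minimum of `w[i : j]`. Positions are
counted from 1, so that the symbol at position `m` is `w[m - 1]?`; used for
`1 ≤ i ≤ j ≤ |w|`. -/
def IsLeftmostMin {α : Type*} [LinearOrder α] (w : List α) (i j k : ℕ) : Prop :=
  i ≤ k ∧ k ≤ j ∧ ∃ a, w[k - 1]? = some a ∧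
    ∀ m b, i ≤ m → m ≤ j → w[m - 1]? = some b → a ≤ b ∧ (m < k → a < b)

/-! ### The word RAM -/

namespace WordRAM

/-- Arithmetic operations on machine words. -/
inductive Op where
  | add | sub | mul | div | mod

/-- The operations on words of `W` bits: addition, subtraction and multiplication modulo `2 ^ W`,
integer quotient and remainder. -/
def Op.eval (W : ℕ) : Op → ℕ → ℕ → ℕ
  | .add, x, y => (x + y) % 2 ^ W
  | .sub, x, y => (x + (2 ^ W - y)) % 2 ^ W
  | .mul, x, y => (x * y) % 2 ^ W
  | .div, x, y => x / y
  | .mod, x, y => x % y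

/-- Instructions; the arguments `d`, `x`, `y` are numbers of registers, `c` is an immediate
constant, and `l` is the number of an instruction of the program. -/
inductive Instr where
  /-- `r[d] := c` -/
  | const (d c : ℕ)
  /-- `r[d] := r[x]` -/
  | move (d x : ℕ)
  /-- `r[d] := r[x] op r[y]` -/
  | arith (op : Op) (d x y : ℕ)
  /-- `r[d] := mem[r[x]]` -/
  | load (d x : ℕ)
  /-- `mem[r[x]] := r[y]` -/
  | store (x y : ℕ)
  /-- go to `l` -/
  | jump (l : ℕ)
  /-- if `r[x] < r[y]` go to `l` -/
  | jumpLt (x y l : ℕ)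
  /-- if `r[x] = r[y]` go to `l` -/
  | jumpEq (x y l : ℕ)
  | halt

/-- A program is a finite list of instructions (so it uses finitely many registers). -/
abbrev Program := List Instr

/-- A configuration: program counter, registers, and a memory of `mem.length` words. -/
structure Config where
  pc : ℕ
  reg : ℕ → ℕ
  mem : List ℕ

/-- The effect of one instruction other than `halt`, on a machine with words of `W` bits;
an access outside of the memory has no result. -/
def Instr.exec (W : ℕ) (s : Config) : Instr → Option Config
  | .const d c => some ⟨s.pc + 1, Function.update s.reg d (c % 2 ^ W), s.mem⟩
  | .move d x => some ⟨s.pc + 1, Function.update s.reg d (s.reg x), s.mem⟩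
  | .arith op d x y =>
      some ⟨s.pc + 1, Function.update s.reg d (op.eval W (s.reg x) (s.reg y)), s.mem⟩
  | .load d x => (s.mem[s.reg x]?).map fun v => ⟨s.pc + 1, Function.update s.reg d v, s.mem⟩
  | .store x y =>
      if s.reg x < s.mem.length then some ⟨s.pc + 1, s.reg, s.mem.set (s.reg x) (s.reg y)⟩
      else none
  | .jump l => some ⟨l, s.reg, s.mem⟩
  | .jumpLt x y l => some ⟨if s.reg x < s.reg y then l else s.pc + 1, s.reg, s.mem⟩
  | .jumpEq x y l => some ⟨if s.reg x = s.reg y then l else s.pc + 1, s.reg, s.mem⟩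
  | .halt => none

/-- One step of the machine: execute the instruction at the program counter. -/
def step (W : ℕ) (P : Program) (s : Config) : Option Config :=
  (P[s.pc]?).bind (Instr.exec W s)

/-- The configuration after exactly `t` steps, if there is one. -/
def run (W : ℕ) (P : Program) : ℕ → Config → Option Config
  | 0, s => some s
  | t + 1, s => (step W P s).bind (run W P t)

/-- The initial configuration: the words `i` and `j` are in registers 0 and 1, the other registers
hold 0, and the memory is `mem`. -/
def start (mem : List ℕ) (i j : ℕ) : Config :=
  ⟨0, fun r => if r = 0 then i else if r = 1 then j else 0, mem⟩

/-- On memory `mem` and input `(i, j)`, the program `P` reaches a `halt` instruction after at most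
`T` steps, with `k` in register 0 and with the memory in its original state. -/
def Answers (W : ℕ) (P : Program) (mem : List ℕ) (i j k T : ℕ) : Prop :=
  ∃ t ≤ T, ∃ s, run W P t (start mem i j) = some s ∧
    P[s.pc]? = some .halt ∧ s.reg 0 = k ∧ s.mem = mem

end WordRAM

/-!
The proof balances a smallest run-length grammar of the string `w` and lets the query program walk
down the balanced grammar.

*Balancing.* Variables are identified with the strings that they derive, and the grammar is first
made binary. Let the multiplicity of a string be the number of its occurrences in the derivation
of `w`. A step from `u` to a part `v` of a concatenation is heavy if neither the length nor the
multiplicity passes a power of two. Every string has at most one heavy successor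
(`Heavy.right_unique`, because the lengths of the parts add up) and at most one heavy predecessor
(`Heavy.left_unique`, because the multiplicities of the users add up). So the strings are
partitioned into heavy paths, and a derivation makes only `O(log |w|)` light steps.

The strings of a heavy path are obtained from its last one by attaching the light parts on the left
and on the right. These light parts are the keys of a binary search tree whose nodes contribute
the concatenation over their subtree and the concatenation from their key up to the end of the
path, so that every string of the path is a concatenation of two such suffixes with the end of the
path inside one of them (`exists_search_tree`). An individual step through this tree costs the
depth at which the path is entered plus the depth at which it is left. The weights that define the
tree add up, suitably scaled, the length of a light part and the number of light occurrences of a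
string. Hence the cost of leaving a path is logarithmic in a quotient of lengths, the cost of
entering it is logarithmic in a quotient of multiplicities, and both telescope along a derivation.
This is made precise by explicit ranks (`baseRank`, `lightRank`) which decrease along every rule of
the new grammar (`exists_strings_of_heavyPath`). Paths are disjoint and every key contributes
boundedly many strings, so the new grammar has size `O(g_rl)` and height `O(log |w|)`
(`exists_isBalanced`).

*Queries.* After empty strings and trivial powers have been removed, every string of the new grammar
is a symbol or has the form `x ^ t y`. The index stores, for each of them, eight words with the
lengths, the addresses and the leftmost minima of `x` and `y` (`exists_memory`). The program
descends to the string where the ends of the query separate, records the minimum of the copies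
between them, and then follows the left end and the right end one after the other, so that it needs
no stack. Candidates found on the way are adjacent to the positions that have been covered already
(`Best`), hence comparing them with the right treatment of ties yields the leftmost minimum
(`halts_descend`, `halts_suffix`, `halts_prefix`).
-/

namespace RLSLP

variable {α : Type*}

/-! ### Grammars and families of strings -/

theorem expand_terminal (G : RLSLP α) {A : Fin (G.top + 1)} {a : α} (h : G.rule A = .terminal a) :
    G.expand A = [a] := by
  rw [expand]; split <;> simp_all

theorem expand_concat (G : RLSLP α) {A : Fin (G.top + 1)} {l : List (Fin (G.top + 1))}
    (h : G.rule A = .concat l) : G.expand A = (l.map G.expand).flatten := by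
  rw [expand]
  split
  · simp_all
  · rename_i l' h'
    rw [h] at h'
    obtain rfl : l = l' := by simpa using h'
    conv_rhs => rw [← List.attach_map_subtype_val l, List.map_map]
    rfl
  · simp_all

theorem expand_power (G : RLSLP α) {A B : Fin (G.top + 1)} {t : ℕ}
    (h : G.rule A = .power B t) : G.expand A = (List.replicate t (G.expand B)).flatten := by
  rw [expand]; split <;> simp_all

theorem expand_ne_nil (G : RLSLP α) (A : Fin (G.top + 1)) : G.expand A ≠ [] := by
  induction A using WellFoundedLT.induction with
  | ind A ih =>
    cases h : G.rule A with
    | terminal a => simp [G.expand_terminal h]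
    | concat l =>
      have hl := G.concat_length A l h
      have hl0 : l ≠ [] := List.ne_nil_of_length_pos (by omega)
      obtain ⟨B, l', rfl⟩ := List.exists_cons_of_ne_nil hl0
      have := ih B (G.concat_lt A _ h B (by simp))
      simp [G.expand_concat h, this]
    | power B t =>
      have ht := G.power_exponent A B t h
      have := ih B (G.power_lt A B t h)
      obtain ⟨t, rfl⟩ : ∃ k, t = k + 1 := ⟨t - 1, by omega⟩
      simp [G.expand_power h, List.replicate_succ, this]

/-- A string of at least two symbols is generated by a program with one terminal variable per
position and a single concatenation. -/
def spelling (w : List α) (hw : 1 < w.length) : RLSLP α where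
  top := w.length
  rule A := if h : A.1 < w.length then .terminal w[A.1] else
    .concat ((List.finRange w.length).map Fin.castSucc)
  concat_length A l h := by
    split at h
    · simp at h
    · simp only [RLRule.concat.injEq] at h; subst h; simpa using hw
  concat_lt A l h B hB := by
    split at h
    · simp at h
    · simp only [RLRule.concat.injEq] at h
      subst h
      simp only [List.mem_map, List.mem_finRange, true_and] at hB
      obtain ⟨i, rfl⟩ := hB
      rw [Fin.lt_def]
      simp only [Fin.val_castSucc]
      omega
  power_exponent A B t h := by split at h <;> simp at h
  power_lt A B t h := by split at h <;> simp at h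

theorem spelling_generated (w : List α) (hw : 1 < w.length) : (spelling w hw).generated = w := by
  have hr : (spelling w hw).rule (Fin.last _) =
      .concat ((List.finRange (spelling w hw).top).map Fin.castSucc) := by
    simp [spelling]
  rw [generated, expand_concat _ hr, List.map_map]
  have : ((spelling w hw).expand ∘ Fin.castSucc) =
      fun i : Fin (spelling w hw).top => [w[i.1]'i.2] := by
    funext i
    exact expand_terminal _ (dif_pos i.2)
  rw [this, ← List.flatMap_def, ← List.map_eq_flatMap]
  exact List.map_getElem_finRange w

theorem spelling_size (w : List α) (hw : 1 < w.length) : (spelling w hw).size = 2 * w.length := by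
  change ∑ A : Fin (w.length + 1), ((spelling w hw).rule A).size = _
  rw [Fin.sum_univ_castSucc]
  simp [spelling, RLRule.size]
  omega

/-- The program with the single rule `A → a`. -/
def single (a : α) : RLSLP α where
  top := 0
  rule _ := .terminal a
  concat_length _ _ h := by simp at h
  concat_lt _ _ h := by simp at h
  power_exponent _ _ _ h := by simp at h
  power_lt _ _ _ h := by simp at h

theorem exists_generated_eq (w : List α) (hw : w ≠ []) :
    ∃ G : RLSLP α, G.generated = w ∧ G.size ≤ 2 * w.length := by
  by_cases h : 1 < w.length
  · exact ⟨spelling w h, spelling_generated w h, (spelling_size w h).le⟩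
  · have h0 := List.length_pos_of_ne_nil hw
    obtain ⟨a, rfl⟩ := List.length_eq_one_iff.1 (by omega : w.length = 1)
    refine ⟨single a, expand_terminal _ rfl, ?_⟩
    change ∑ A : Fin 1, _ ≤ _
    simp [single, RLRule.size]

theorem exists_size_eq_grl (w : List α) (hw : w ≠ []) :
    ∃ G : RLSLP α, G.generated = w ∧ G.size = grl w := by
  obtain ⟨G, hG, -⟩ := exists_generated_eq w hw
  have hne : {s | ∃ G : RLSLP α, G.generated = w ∧ G.size = s}.Nonempty := ⟨_, G, hG, rfl⟩
  exact Nat.sInf_mem hne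

theorem grl_le (w : List α) (hw : w ≠ []) : grl w ≤ 2 * w.length := by
  obtain ⟨G, hG, h⟩ := exists_generated_eq w hw
  have hmem : G.size ∈ {s | ∃ G : RLSLP α, G.generated = w ∧ G.size = s} := ⟨G, hG, rfl⟩
  exact (Nat.sInf_le hmem).trans h

end RLSLP

namespace BalancedRLSLP

variable {α : Type*}

/-- A way to write a string: a single symbol, a concatenation of two strings, or a power. -/
inductive Splitting (α : Type*) where
  | symbol
  | cat (x y : List α)
  | pow (x : List α) (t : ℕ)

/-- `v` is one of the strings used by `r`. -/
def Splitting.Uses : Splitting α → List α → Prop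
  | .symbol, _ => False
  | .cat x y, v => v = x ∨ v = y
  | .pow x _, v => v = x

/-- A set of nonempty strings with, for every string of the set, a splitting into strings of the
set. It is a binary run-length grammar whose variables are identified with their expansions;
there is no need for an order of the variables, because the parts of a splitting are shorter. -/
structure IsFamily (S : Finset (List α)) (R : List α → Splitting α) : Prop where
  ne_nil : ∀ u ∈ S, u ≠ []
  symbol : ∀ u ∈ S, R u = .symbol → ∃ a, u = [a]
  cat : ∀ u ∈ S, ∀ x y, R u = .cat x y → x ∈ S ∧ y ∈ S ∧ u = x ++ y
  pow : ∀ u ∈ S, ∀ x t, R u = .pow x t → x ∈ S ∧ 2 ≤ t ∧ u = (List.replicate t x).flatten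

/-- The strings contributed by a variable: its expansion and, for a concatenation, the expansions
of the suffixes of at least two variables of its right-hand side. -/
theorem exists_strings_of_rule (G : RLSLP α) (A : Fin (G.top + 1)) :
    ∃ T : Finset (List α), T.card ≤ (G.rule A).size ∧ G.expand A ∈ T ∧
      ∀ u ∈ T, u ≠ [] ∧ ((∃ a, u = [a]) ∨
        (∃ B y, (y ∈ T ∨ ∃ D, y = G.expand D) ∧ u = G.expand B ++ y) ∨
        ∃ B t, 2 ≤ t ∧ u = (List.replicate t (G.expand B)).flatten) := by
  classical
  cases h : G.rule A with
  | terminal a =>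
    refine ⟨{[a]}, by simp [RLRule.size], by simp [G.expand_terminal h], ?_⟩
    simp
  | power B t =>
    have ht := G.power_exponent A B t h
    refine ⟨{G.expand A}, by simp [RLRule.size], by simp, ?_⟩
    intro u hu
    obtain rfl := Finset.mem_singleton.1 hu
    exact ⟨G.expand_ne_nil A, Or.inr (Or.inr ⟨B, t, by omega, G.expand_power h⟩)⟩
  | concat l =>
    have hl := G.concat_length A l h
    refine ⟨(Finset.range (l.length - 1)).image fun p => ((l.drop p).map G.expand).flatten,
      ?_, ?_, ?_⟩
    · refine Finset.card_image_le.trans ?_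
      simp [RLRule.size]
    · refine Finset.mem_image.2 ⟨0, by simp; omega, ?_⟩
      simp [G.expand_concat h]
    · intro u hu
      obtain ⟨p, hp, rfl⟩ := Finset.mem_image.1 hu
      rw [Finset.mem_range] at hp
      have hd : l.drop p = l[p] :: l.drop (p + 1) := List.drop_eq_getElem_cons (by omega)
      have he : ((l.drop p).map G.expand).flatten =
          G.expand l[p] ++ ((l.drop (p + 1)).map G.expand).flatten := by
        rw [hd, List.map_cons, List.flatten_cons]
      refine ⟨?_, Or.inr (Or.inl ⟨l[p], _, ?_, he⟩)⟩
      · rw [he]; simp [G.expand_ne_nil]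
      · by_cases hp' : p + 1 < l.length - 1
        · exact Or.inl (Finset.mem_image.2 ⟨p + 1, by simpa using hp', rfl⟩)
        · refine Or.inr ⟨l[p + 1], ?_⟩
          have : l.drop (p + 1) = [l[p + 1]] := by
            rw [List.drop_eq_getElem_cons (by omega), List.drop_eq_nil_of_le (by omega)]
          rw [this]; simp

theorem exists_isFamily (G : RLSLP α) :
    ∃ S R, IsFamily (α := α) S R ∧ G.generated ∈ S ∧ S.card ≤ G.size := by
  classical
  choose T hcard hmem hT using exists_strings_of_rule G
  have hS : ∀ A, G.expand A ∈ Finset.univ.biUnion T := fun A =>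
    Finset.mem_biUnion.2 ⟨A, Finset.mem_univ _, hmem A⟩
  have key : ∀ u : List α, ∃ r : Splitting α, u ∈ Finset.univ.biUnion T →
      u ≠ [] ∧ (r = .symbol → ∃ a, u = [a]) ∧
      (∀ x y, r = .cat x y → x ∈ Finset.univ.biUnion T ∧ y ∈ Finset.univ.biUnion T ∧ u = x ++ y) ∧
      (∀ x t, r = .pow x t → x ∈ Finset.univ.biUnion T ∧ 2 ≤ t ∧
        u = (List.replicate t x).flatten) := by
    intro u
    by_cases hu : u ∈ Finset.univ.biUnion T
    · obtain ⟨A, -, hA⟩ := Finset.mem_biUnion.1 hu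
      obtain ⟨h0, ⟨a, ha⟩ | ⟨B, y, hy, hu'⟩ | ⟨B, t, ht, hu'⟩⟩ := hT A u hA
      · exact ⟨.symbol, fun _ => ⟨h0, fun _ => ⟨a, ha⟩, by simp, by simp⟩⟩
      · refine ⟨.cat (G.expand B) y, fun _ => ⟨h0, by simp, ?_, by simp⟩⟩
        intro x' y' h
        simp only [Splitting.cat.injEq] at h
        obtain ⟨rfl, rfl⟩ := h
        refine ⟨hS B, ?_, hu'⟩
        obtain hy | ⟨D, rfl⟩ := hy
        · exact Finset.mem_biUnion.2 ⟨A, Finset.mem_univ _, hy⟩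
        · exact hS D
      · refine ⟨.pow (G.expand B) t, fun _ => ⟨h0, by simp, by simp, ?_⟩⟩
        intro x' t' h
        simp only [Splitting.pow.injEq] at h
        obtain ⟨rfl, rfl⟩ := h
        exact ⟨hS B, ht, hu'⟩
    · exact ⟨.symbol, fun h => absurd h hu⟩
  choose R hR using key
  refine ⟨Finset.univ.biUnion T, R, ⟨fun u hu => (hR u hu).1, fun u hu => (hR u hu).2.1,
    fun u hu => (hR u hu).2.2.1, fun u hu => (hR u hu).2.2.2⟩, hS _, ?_⟩
  exact Finset.card_biUnion_le.trans (Finset.sum_le_sum fun A _ => hcard A)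

end BalancedRLSLP

namespace BalancedRLSLP

variable {α : Type*}

/-! ### Multiplicities -/

theorem IsFamily.length_lt_of_uses {S : Finset (List α)} {R : List α → Splitting α}
    (h : IsFamily S R) {u v : List α} (hu : u ∈ S) (hv : (R u).Uses v) :
    v ∈ S ∧ v.length < u.length := by
  cases hr : R u with
  | symbol => simp [hr, Splitting.Uses] at hv
  | cat x y =>
    obtain ⟨hx, hy, rfl⟩ := h.cat u hu x y hr
    have h1 := List.length_pos_of_ne_nil (h.ne_nil x hx)
    have h2 := List.length_pos_of_ne_nil (h.ne_nil y hy)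
    rw [hr] at hv
    obtain rfl | rfl := hv
    · exact ⟨hx, by simp; omega⟩
    · exact ⟨hy, by simp; omega⟩
  | pow x t =>
    obtain ⟨hx, ht, hu'⟩ := h.pow u hu x t hr
    have h1 := List.length_pos_of_ne_nil (h.ne_nil x hx)
    rw [hr] at hv
    obtain rfl := hv
    refine ⟨hx, ?_⟩
    rw [hu']
    simp
    nlinarith

/-- `o v` counts occurrences of `v` in the derivation tree of `w` (a power being counted as a
single occurrence of its base): distinct occurrences of `v` cover distinct positions of `w`, and
each occurrence of a string that uses `v` brings an occurrence of `v` with it. -/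
structure IsMultiplicity (S : Finset (List α)) (R : List α → Splitting α) (w : List α)
    (o : List α → ℕ) : Prop where
  mul_length_le : ∀ v ∈ S, o v * v.length ≤ w.length
  sum_le : ∀ v ∈ S, ∀ T ⊆ S, (∀ u ∈ T, (R u).Uses v) → v ∉ T → ∑ u ∈ T, o u ≤ o v
  pos : ∀ v ∈ S, 1 ≤ o v

open Classical in
theorem exists_count {S : Finset (List α)} {R : List α → Splitting α} (h : IsFamily S R) :
    ∀ r ∈ S, ∃ c : List α → ℕ, ∀ v ∈ S, c v * v.length ≤ r.length ∧
      (∑ u ∈ S with (R u).Uses v, c u) + (if v = r then 1 else 0) ≤ c v := by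
  intro r
  induction hn : r.length using Nat.strong_induction_on generalizing r with
  | _ n ih =>
    intro hr
    subst hn
    have hvan : ∀ x ∈ S, x.length < r.length → ∀ c : List α → ℕ,
        (∀ v ∈ S, c v * v.length ≤ x.length ∧
          (∑ u ∈ S with (R u).Uses v, c u) + (if v = x then 1 else 0) ≤ c v) → c r = 0 := by
      intro x hx hlt c hc
      by_contra h0
      have := (hc r hr).1
      have := Nat.le_mul_of_pos_left r.length (Nat.pos_of_ne_zero h0)
      omega
    have hdelta : ∀ v, (∑ u ∈ S with (R u).Uses v, if u = r then 1 else 0) =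
        if (R r).Uses v then 1 else 0 := by
      intro v
      rw [Finset.sum_ite_eq']
      simp [hr]
    have hself : ¬ (R r).Uses r := fun hh => (h.length_lt_of_uses hr hh).2.false
    cases hrr : R r with
    | symbol =>
      refine ⟨fun v => if v = r then 1 else 0, fun v hv => ⟨?_, ?_⟩⟩
      · dsimp only
        split_ifs with hvr <;> simp [*]
      · rw [hdelta, hrr]; simp [Splitting.Uses]
    | cat x y =>
      obtain ⟨hx, hy, hxy⟩ := h.cat r hr x y hrr
      have hxl := (h.length_lt_of_uses hr (v := x) (by simp [hrr, Splitting.Uses])).2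
      have hyl := (h.length_lt_of_uses hr (v := y) (by simp [hrr, Splitting.Uses])).2
      obtain ⟨c, hc⟩ := ih _ hxl x rfl hx
      obtain ⟨c', hc'⟩ := ih _ hyl y rfl hy
      have hc0 := hvan x hx hxl c hc
      have hc0' := hvan y hy hyl c' hc'
      refine ⟨fun v => c v + c' v + if v = r then 1 else 0, fun v hv => ⟨?_, ?_⟩⟩
      · dsimp only
        split_ifs with hvr
        · subst hvr; simp [hc0, hc0']
        · have := (hc v hv).1
          have := (hc' v hv).1
          have : r.length = x.length + y.length := by rw [hxy]; simp
          rw [add_zero, add_mul]; omega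
      · rw [Finset.sum_add_distrib, Finset.sum_add_distrib, hdelta, hrr]
        have h1 := (hc v hv).2
        have h2 := (hc' v hv).2
        have hU : (Splitting.cat x y).Uses v ↔ v = x ∨ v = y := Iff.rfl
        simp only [hU]
        split_ifs at h1 h2 ⊢ <;> first | omega | (exfalso; simp_all)
    | pow x t =>
      obtain ⟨hx, -, -⟩ := h.pow r hr x t hrr
      have hxl := (h.length_lt_of_uses hr (v := x) (by simp [hrr, Splitting.Uses])).2
      obtain ⟨c, hc⟩ := ih _ hxl x rfl hx
      have hc0 := hvan x hx hxl c hc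
      refine ⟨fun v => c v + if v = r then 1 else 0, fun v hv => ⟨?_, ?_⟩⟩
      · dsimp only
        split_ifs with hvr
        · subst hvr; simp [hc0]
        · have := (hc v hv).1
          rw [add_zero]; omega
      · rw [Finset.sum_add_distrib, hdelta, hrr]
        have h1 := (hc v hv).2
        have hU : (Splitting.pow x t).Uses v ↔ v = x := Iff.rfl
        simp only [hU]
        split_ifs at h1 ⊢ <;> omega

/-- Every string of a family that occurs in the derivation of `w` has a multiplicity; the other
strings of the family are dropped. -/
theorem exists_isMultiplicity {S : Finset (List α)} {R : List α → Splitting α}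
    (h : IsFamily S R) {w : List α} (hw : w ∈ S) :
    ∃ S' o, S' ⊆ S ∧ w ∈ S' ∧ IsFamily S' R ∧ IsMultiplicity S' R w o := by
  classical
  obtain ⟨c, hc⟩ := exists_count h w hw
  have hle : ∀ v ∈ S, ∀ T ⊆ S, (∀ u ∈ T, (R u).Uses v) → ∑ u ∈ T, c u ≤ c v := by
    intro v hv T hT hTv
    refine le_trans ?_ (le_trans (Nat.le_add_right _ _) (hc v hv).2)
    exact Finset.sum_le_sum_of_subset fun u hu => Finset.mem_filter.2 ⟨hT hu, hTv u hu⟩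
  have hle1 : ∀ u ∈ S, ∀ v, (R u).Uses v → c u ≤ c v := by
    intro u hu v huv
    have := hle v (h.length_lt_of_uses hu huv).1 {u} (by simpa using hu) (by simpa using huv)
    simpa using this
  have hsub : ∀ u ∈ S.filter (1 ≤ c ·), ∀ v, (R u).Uses v → v ∈ S.filter (1 ≤ c ·) := by
    intro u hu v huv
    rw [Finset.mem_filter] at hu ⊢
    exact ⟨(h.length_lt_of_uses hu.1 huv).1, hu.2.trans (hle1 u hu.1 v huv)⟩
  have hmem : ∀ u ∈ S.filter (1 ≤ c ·), u ∈ S := fun u hu => (Finset.mem_filter.1 hu).1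
  refine ⟨S.filter (1 ≤ c ·), c, Finset.filter_subset _ _, ?_, ⟨?_, ?_, ?_, ?_⟩, ⟨?_, ?_, ?_⟩⟩
  · refine Finset.mem_filter.2 ⟨hw, le_trans ?_ (hc w hw).2⟩
    simp
  · exact fun u hu => h.ne_nil u (hmem u hu)
  · exact fun u hu => h.symbol u (hmem u hu)
  · intro u hu x y hr
    exact ⟨hsub u hu x (by simp [hr, Splitting.Uses]), hsub u hu y (by simp [hr, Splitting.Uses]),
      (h.cat u (hmem u hu) x y hr).2.2⟩
  · intro u hu x t hr
    exact ⟨hsub u hu x (by simp [hr, Splitting.Uses]), (h.pow u (hmem u hu) x t hr).2⟩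
  · exact fun v hv => (hc v (hmem v hv)).1
  · exact fun v hv T hT hTv _ => hle v (hmem v hv) T (fun u hu => hmem u (hT hu)) hTv
  · exact fun v hv => (Finset.mem_filter.1 hv).2

/-! ### Weighted search trees -/

/-- `s` is in `G` with some rank of at most `r`. -/
def Has (G : Finset (List α × ℕ)) (s : List α) (r : ℕ) : Prop :=
  ∃ r' ≤ r, (s, r') ∈ G

/-- The string `s` of rank `r` is trivial, or a concatenation or a power of strings of `G` of
smaller ranks. -/
def Derivable (G : Finset (List α × ℕ)) (s : List α) (r : ℕ) : Prop :=
  s = [] ∨ (∃ a, s = [a]) ∨ ∃ m < r,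
    (∃ x y, Has G x m ∧ Has G y m ∧ s = x ++ y) ∨
      ∃ x t, Has G x m ∧ s = (List.replicate t x).flatten

theorem Has.mono {G G' : Finset (List α × ℕ)} {s : List α} {r r' : ℕ} (h : Has G s r)
    (hG : G ⊆ G') (hr : r ≤ r') : Has G' s r' :=
  let ⟨q, hq, hs⟩ := h
  ⟨q, hq.trans hr, hG hs⟩

theorem Derivable.of_cat {G : Finset (List α × ℕ)} {x y : List α} {r m : ℕ} (hx : Has G x m)
    (hy : Has G y m) (h : m < r) : Derivable G (x ++ y) r :=
  Or.inr (Or.inr ⟨m, h, Or.inl ⟨x, y, hx, hy, rfl⟩⟩)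

/-- The strings that the keys of a list put in front of a common middle string. -/
def fronts {κ : Type*} (a : κ → List α) : List κ → List α
  | [] => []
  | k :: q => a k ++ fronts a q

/-- The strings that the keys of a list put behind a common middle string; the last key is the
innermost one. -/
def backs {κ : Type*} (b : κ → List α) : List κ → List α
  | [] => []
  | k :: q => backs b q ++ b k

theorem fronts_append {κ : Type*} (a : κ → List α) (p q : List κ) :
    fronts a (p ++ q) = fronts a p ++ fronts a q := by
  induction p with
  | nil => rfl
  | cons k p ih => simp [fronts, ih]

theorem backs_append {κ : Type*} (b : κ → List α) (p q : List κ) :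
    backs b (p ++ q) = backs b q ++ backs b p := by
  induction p with
  | nil => simp [backs]
  | cons k p ih => simp [backs, ih]

/-- A nonempty weighted list has a weighted median. -/
theorem exists_median {κ : Type*} (wt : κ → ℕ) (q : List κ) (hq : q ≠ []) :
    ∃ u k v, q = u ++ k :: v ∧ 2 * (u.map wt).sum ≤ (q.map wt).sum ∧
      2 * (v.map wt).sum ≤ (q.map wt).sum := by
  have key : ∀ (q : List κ) (c T : ℕ), q ≠ [] → T = c + (q.map wt).sum → 2 * c ≤ T →
      ∃ u k v, q = u ++ k :: v ∧ 2 * (c + (u.map wt).sum) ≤ T ∧ 2 * (v.map wt).sum ≤ T := by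
    intro q
    induction q with
    | nil => simp
    | cons k q ih =>
      intro c T _ hT hc
      simp only [List.map_cons, List.sum_cons] at hT
      by_cases hk : 2 * (c + wt k) ≤ T ∧ q ≠ []
      · obtain ⟨u, k', v, rfl, h1, h2⟩ := ih (c + wt k) T hk.2 (by omega) hk.1
        exact ⟨k :: u, k', v, rfl, by simp; omega, h2⟩
      · refine ⟨[], k, q, rfl, by simpa using hc, ?_⟩
        by_cases h0 : q = []
        · simp [h0]
        · have : ¬ 2 * (c + wt k) ≤ T := fun hh => hk ⟨hh, h0⟩
          omega
  simpa using key q 0 _ hq (by simp) (by simp)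

/-- Strings for all the suffixes of a list `q` of keys, each continued by `SL` and `SR`. The keys
are arranged in a binary search tree of weighted medians, so that a key of weight `wt k` in a list
of total weight at most `2 ^ N` has a depth `e` with `wt k * 2 ^ e ≤ 2 ^ N`. Every node of the
tree contributes the string of its subtree, whose rank decreases with the depth, and the string of
the suffix that starts with its key, whose rank increases with the depth: a suffix consists of its
first key, of the right subtree below that key, and of a suffix that starts with a key on the way
to the root. -/
theorem exists_search_tree {κ : Type*} (a b : κ → List α) (wt rk : κ → ℕ) (N E : ℕ) (q : List κ)
    (hrk : ∀ k ∈ q, ∀ e, wt k * 2 ^ e ≤ 2 ^ N → rk k + 2 * e + 2 ≤ E) (d : ℕ)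
    (SL SR : List α) (hsum : (q.map wt).sum * 2 ^ d ≤ 2 ^ N) :
    ∃ F : Finset (List α × ℕ), F.card ≤ 6 * q.length ∧
      (∀ G, F ⊆ G → Has G [] 0 → (∀ k ∈ q, Has G (a k) (rk k) ∧ Has G (b k) (rk k)) →
        Has G SL (E + d) → Has G SR (E + d) →
          (∀ p ∈ F, Derivable G p.1 p.2) ∧ Has G (fronts a q) (E - 2 * d) ∧
            Has G (backs b q) (E - 2 * d)) ∧
      ∀ u k v, q = u ++ k :: v → ∃ e, wt k * 2 ^ e ≤ 2 ^ N ∧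
        Has F (fronts a (k :: v) ++ SL) (E + e + 1) ∧
        Has F (SR ++ backs b (k :: v)) (E + e + 1) := by
  classical
  induction hn : q.length using Nat.strong_induction_on generalizing q d SL SR with
  | _ n ih =>
    subst hn
    rcases eq_or_ne q [] with rfl | hq
    · refine ⟨∅, by simp, fun G _ h0 _ _ _ => ⟨by simp, h0.mono subset_rfl (by simp),
        h0.mono subset_rfl (by simp)⟩, by simp⟩
    obtain ⟨u, k, v, hquv, hu, hv⟩ := exists_median wt q hq
    have hk : k ∈ q := by simp [hquv]
    have hwk : wt k * 2 ^ d ≤ 2 ^ N := by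
      refine le_trans (Nat.mul_le_mul_right _ ?_) hsum
      exact List.single_le_sum (by simp) _ (List.mem_map_of_mem hk)
    have hkE := hrk k hk d hwk
    have half : ∀ x : ℕ, 2 * x ≤ (q.map wt).sum → x * 2 ^ (d + 1) ≤ 2 ^ N := by
      intro x hx
      refine le_trans ?_ hsum
      rw [pow_succ, mul_comm (2 ^ d), ← mul_assoc, mul_comm x]
      exact Nat.mul_le_mul_right _ hx
    have hlen : q.length = u.length + v.length + 1 := by simp [hquv]; omega
    obtain ⟨Fv, hFv, hFv1, hFv2⟩ := ih v.length (by omega) v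
      (fun k hk => hrk k (by simp [hquv, hk])) (d + 1) SL SR (half _ hv) rfl
    obtain ⟨Fu, hFu, hFu1, hFu2⟩ := ih u.length (by omega) u
      (fun k hk => hrk k (by simp [hquv, hk])) (d + 1) (fronts a (k :: v) ++ SL)
      (SR ++ backs b (k :: v)) (half _ hu) rfl
    let F0 : Finset (List α × ℕ) := {(fronts a (k :: v), E - 2 * d - 1),
      (backs b (k :: v), E - 2 * d - 1), (fronts a q, E - 2 * d), (backs b q, E - 2 * d),
      (fronts a (k :: v) ++ SL, E + d + 1), (SR ++ backs b (k :: v), E + d + 1)}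
    have hF0 : F0.card ≤ 6 := Finset.card_le_six
    have hF0' : ∀ p ∈ F0, p = (fronts a (k :: v), E - 2 * d - 1) ∨
        p = (backs b (k :: v), E - 2 * d - 1) ∨ p = (fronts a q, E - 2 * d) ∨
        p = (backs b q, E - 2 * d) ∨ p = (fronts a (k :: v) ++ SL, E + d + 1) ∨
        p = (SR ++ backs b (k :: v), E + d + 1) := by simp [F0]
    refine ⟨F0 ∪ (Fu ∪ Fv), ?_, ?_, ?_⟩
    · have h1 := Finset.card_union_le F0 (Fu ∪ Fv)
      have h2 := Finset.card_union_le Fu Fv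
      omega
    · intro G hG h0 hab hSL hSR
      have hG0 : F0 ⊆ G := Finset.subset_union_left.trans hG
      have hGu : Fu ⊆ G := (Finset.subset_union_left.trans Finset.subset_union_right).trans hG
      have hGv : Fv ⊆ G := (Finset.subset_union_right.trans Finset.subset_union_right).trans hG
      have m1 : Has G (fronts a (k :: v)) (E - 2 * d - 1) := ⟨_, le_rfl, hG0 (by simp [F0])⟩
      have m2 : Has G (backs b (k :: v)) (E - 2 * d - 1) := ⟨_, le_rfl, hG0 (by simp [F0])⟩
      have m3 : Has G (fronts a q) (E - 2 * d) := ⟨_, le_rfl, hG0 (by simp [F0])⟩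
      have m4 : Has G (backs b q) (E - 2 * d) := ⟨_, le_rfl, hG0 (by simp [F0])⟩
      have m5 : Has G (fronts a (k :: v) ++ SL) (E + d + 1) := ⟨_, le_rfl, hG0 (by simp [F0])⟩
      have m6 : Has G (SR ++ backs b (k :: v)) (E + d + 1) := ⟨_, le_rfl, hG0 (by simp [F0])⟩
      obtain ⟨dv, lv, rv⟩ := hFv1 G hGv h0 (fun k hk => hab k (by simp [hquv, hk]))
        (hSL.mono subset_rfl (by omega)) (hSR.mono subset_rfl (by omega))
      obtain ⟨du, lu, ru⟩ := hFu1 G hGu h0 (fun k hk => hab k (by simp [hquv, hk]))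
        (m5.mono subset_rfl (by omega)) (m6.mono subset_rfl (by omega))
      refine ⟨?_, m3, m4⟩
      intro p hp
      rcases Finset.mem_union.1 hp with hp | hp
      · rcases hF0' p hp with rfl | rfl | rfl | rfl | rfl | rfl
        · exact Derivable.of_cat (m := E - 2 * d - 2) ((hab k hk).1.mono subset_rfl (by omega))
            (lv.mono subset_rfl (by omega)) (by simp only []; omega)
        · exact Derivable.of_cat (m := E - 2 * d - 2) (rv.mono subset_rfl (by omega))
            ((hab k hk).2.mono subset_rfl (by omega)) (by simp only []; omega)
        · simp only [hquv, fronts_append]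
          exact Derivable.of_cat (m := E - 2 * d - 1) (lu.mono subset_rfl (by omega)) m1 (by omega)
        · simp only [hquv, backs_append]
          exact Derivable.of_cat (m := E - 2 * d - 1) m2 (ru.mono subset_rfl (by omega)) (by omega)
        · exact Derivable.of_cat (m := E + d) (m1.mono subset_rfl (by omega)) hSL (by simp)
        · exact Derivable.of_cat (m := E + d) hSR (m2.mono subset_rfl (by omega)) (by simp)
      · rcases Finset.mem_union.1 hp with hp | hp
        · exact du p hp
        · exact dv p hp
    · intro u' k' v' h'
      have hsu : Fu ⊆ F0 ∪ (Fu ∪ Fv) :=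
        Finset.subset_union_left.trans Finset.subset_union_right
      have hsv : Fv ⊆ F0 ∪ (Fu ∪ Fv) :=
        Finset.subset_union_right.trans Finset.subset_union_right
      rw [hquv] at h'
      rcases List.append_eq_append_iff.1 h' with ⟨c, hc1, hc2⟩ | ⟨c, hc1, hc2⟩
      · rcases c with _ | ⟨c0, c⟩
        · simp only [List.nil_append, List.cons.injEq] at hc2
          obtain ⟨rfl, rfl⟩ := hc2
          exact ⟨d, hwk, ⟨_, le_rfl, by simp [F0]⟩, ⟨_, le_rfl, by simp [F0]⟩⟩
        · simp only [List.cons_append, List.cons.injEq] at hc2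
          obtain ⟨rfl, hv'⟩ := hc2
          obtain ⟨e, he, h1, h2⟩ := hFv2 _ _ _ hv'
          exact ⟨e, he, h1.mono hsv le_rfl, h2.mono hsv le_rfl⟩
      · rcases c with _ | ⟨c0, c⟩
        · simp only [List.nil_append, List.cons.injEq] at hc2
          obtain ⟨rfl, rfl⟩ := hc2
          exact ⟨d, hwk, ⟨_, le_rfl, by simp [F0]⟩, ⟨_, le_rfl, by simp [F0]⟩⟩
        · simp only [List.cons_append, List.cons.injEq] at hc2
          obtain ⟨rfl, rfl⟩ := hc2
          obtain ⟨e, he, h1, h2⟩ := hFu2 _ _ _ hc1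
          refine ⟨e, he, ?_, ?_⟩
          · have := h1.mono hsu le_rfl
            rwa [← List.append_assoc, ← fronts_append] at this
          · have := h2.mono hsu le_rfl
            rwa [List.append_assoc, ← backs_append] at this

end BalancedRLSLP

namespace BalancedRLSLP

variable {α : Type*}

/-! ### Heavy paths -/

/-- The step from a concatenation `u` to one of its parts `v` is heavy if the lengths of `u` and
`v`, and also their multiplicities, agree up to rounding down to a power of two. -/
def Heavy (S : Finset (List α)) (R : List α → Splitting α) (o : List α → ℕ) (u v : List α) : Prop :=
  u ∈ S ∧ (∃ x y, R u = .cat x y ∧ (v = x ∨ v = y)) ∧ Nat.log 2 (o v) = Nat.log 2 (o u) ∧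
    Nat.log 2 v.length = Nat.log 2 u.length

section

variable {S : Finset (List α)} {R : List α → Splitting α} {o : List α → ℕ} {w : List α}

theorem Heavy.uses {u v : List α} (h : Heavy S R o u v) : (R u).Uses v := by
  obtain ⟨-, ⟨x, y, hr, hv⟩, -⟩ := h
  rw [hr]
  exact hv

theorem Heavy.mem_right (hF : IsFamily S R) {u v : List α} (h : Heavy S R o u v) : v ∈ S :=
  (hF.length_lt_of_uses h.1 h.uses).1

theorem le_of_uses (hF : IsFamily S R) (hM : IsMultiplicity S R w o) {u v : List α} (hu : u ∈ S)
    (huv : (R u).Uses v) : o u ≤ o v := by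
  obtain ⟨hv, hlt⟩ := hF.length_lt_of_uses hu huv
  have := hM.sum_le v hv {u} (by simpa using hu) (by simpa using huv)
    (by simp only [Finset.mem_singleton]; rintro rfl; exact hlt.false)
  simpa using this

theorem log_lt_of_add_le {a b c : ℕ} (ha : a ≠ 0) (hb : b ≠ 0)
    (hab : Nat.log 2 a = Nat.log 2 b) (h : a + b ≤ c) : Nat.log 2 a < Nat.log 2 c := by
  have h1 := Nat.pow_log_le_self 2 ha
  have h2 := Nat.pow_log_le_self 2 hb
  rw [← hab] at h2
  refine Nat.lt_of_succ_le (Nat.le_log_of_pow_le (by norm_num) ?_)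
  rw [pow_succ]
  omega

/-- Two parts of a concatenation cannot both have more than half of its length. -/
theorem Heavy.right_unique (hF : IsFamily S R) {u v v' : List α} (h : Heavy S R o u v)
    (h' : Heavy S R o u v') : v = v' := by
  obtain ⟨hu, ⟨x, y, hr, hv⟩, -, hl⟩ := h
  obtain ⟨-, ⟨x', y', hr', hv'⟩, -, hl'⟩ := h'
  rw [hr] at hr'
  simp only [Splitting.cat.injEq] at hr'
  obtain ⟨rfl, rfl⟩ := hr'
  obtain ⟨hx, hy, hxy⟩ := hF.cat u hu x y hr
  have hx0 := List.length_pos_of_ne_nil (hF.ne_nil x hx)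
  have hy0 := List.length_pos_of_ne_nil (hF.ne_nil y hy)
  by_contra hne
  have hxl : Nat.log 2 x.length = Nat.log 2 u.length := by grind
  have hyl : Nat.log 2 y.length = Nat.log 2 u.length := by grind
  have := log_lt_of_add_le (c := u.length) hx0.ne' hy0.ne' (hxl.trans hyl.symm) (by rw [hxy]; simp)
  omega

/-- Two strings that use the same string cannot both have more than half of its multiplicity. -/
theorem Heavy.left_unique (hF : IsFamily S R) (hM : IsMultiplicity S R w o) {u u' v : List α}
    (h : Heavy S R o u v) (h' : Heavy S R o u' v) : u = u' := by
  classical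
  by_contra hne
  have hv := h.mem_right hF
  have h1 := hM.pos u h.1
  have h2 := hM.pos u' h'.1
  have hs := hM.sum_le v hv {u, u'} (by simp [Finset.insert_subset_iff, h.1, h'.1])
    (by simp [h.uses, h'.uses]) (by
      have := (hF.length_lt_of_uses h.1 h.uses).2
      have := (hF.length_lt_of_uses h'.1 h'.uses).2
      simp only [Finset.mem_insert, Finset.mem_singleton]
      rintro (rfl | rfl) <;> omega)
  rw [Finset.sum_pair hne] at hs
  have := log_lt_of_add_le (by omega) (by omega) (h.2.2.1.symm.trans h'.2.2.1) hs
  have := h.2.2.1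
  omega

theorem log_of_not_heavy (hF : IsFamily S R) (hM : IsMultiplicity S R w o) {u v : List α}
    (hu : u ∈ S) (huv : (R u).Uses v) (h : ¬ Heavy S R o u v) :
    Nat.log 2 (o u) ≤ Nat.log 2 (o v) ∧ Nat.log 2 v.length ≤ Nat.log 2 u.length ∧
      (Nat.log 2 (o u) < Nat.log 2 (o v) ∨ Nat.log 2 v.length < Nat.log 2 u.length) := by
  have h1 : Nat.log 2 (o u) ≤ Nat.log 2 (o v) := Nat.log_mono_right (le_of_uses hF hM hu huv)
  have h2 : Nat.log 2 v.length ≤ Nat.log 2 u.length :=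
    Nat.log_mono_right (hF.length_lt_of_uses hu huv).2.le
  refine ⟨h1, h2, ?_⟩
  by_contra hcon
  cases hr : R u with
  | symbol => simp [hr, Splitting.Uses] at huv
  | cat x y =>
    refine h ⟨hu, ⟨x, y, hr, ?_⟩, by omega, by omega⟩
    rw [hr] at huv
    exact huv
  | pow x t =>
    obtain ⟨hx, ht, hu'⟩ := hF.pow u hu x t hr
    have hx0 := List.length_pos_of_ne_nil (hF.ne_nil x hx)
    rw [hr] at huv
    obtain rfl := huv
    have hl : v.length + v.length ≤ u.length := by
      rw [hu']
      simp
      nlinarith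
    have := log_lt_of_add_le hx0.ne' hx0.ne' rfl hl
    omega

/-- `a u` and `b u` are the strings to the left and to the right of the heavy part of `u`; one of
them is empty and the other one is the light part of `u`. -/
def IsContext (S : Finset (List α)) (R : List α → Splitting α) (o : List α → ℕ)
    (a b : List α → List α) : Prop :=
  ∀ u v, Heavy S R o u v → u = a u ++ v ++ b u ∧ (a u = [] ∨ b u = []) ∧
    (R u).Uses (a u ++ b u) ∧ ¬ Heavy S R o u (a u ++ b u)

theorem exists_isContext (hF : IsFamily S R) : ∃ a b, IsContext S R o a b := by
  have key : ∀ u, ∃ a b : List α, ∀ v, Heavy S R o u v → u = a ++ v ++ b ∧ (a = [] ∨ b = []) ∧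
      (R u).Uses (a ++ b) ∧ ¬ Heavy S R o u (a ++ b) := by
    intro u
    by_cases h : ∃ v, Heavy S R o u v
    · obtain ⟨v, hv⟩ := h
      obtain ⟨hu, ⟨x, y, hr, hxy⟩, -⟩ := id hv
      obtain ⟨hx, hy, hu'⟩ := hF.cat u hu x y hr
      -- the light part is not heavy, since otherwise both parts would equal `v`
      have hlight : ∀ z, Heavy S R o u z → u = v ++ z ∨ u = z ++ v → False := by
        intro z hz hu2
        obtain rfl := hz.right_unique hF hv
        have h0 := List.length_pos_of_ne_nil (hF.ne_nil z (hz.mem_right hF))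
        have hl : z.length + z.length ≤ u.length := by
          obtain h | h := hu2 <;> (rw [h]; simp)
        have := log_lt_of_add_le h0.ne' h0.ne' rfl hl
        have := hz.2.2.2
        omega
      obtain rfl | rfl := hxy
      · refine ⟨[], y, fun v' hv' => ?_⟩
        obtain rfl := hv'.right_unique hF hv
        refine ⟨by simpa using hu', by simp, by simp [hr, Splitting.Uses], fun hh => ?_⟩
        exact hlight _ hh (Or.inl (by simpa using hu'))
      · refine ⟨x, [], fun v' hv' => ?_⟩
        obtain rfl := hv'.right_unique hF hv
        refine ⟨by simpa using hu', by simp, by simp [hr, Splitting.Uses], fun hh => ?_⟩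
        exact hlight _ hh (Or.inr (by simpa using hu'))
    · exact ⟨[], [], fun v hv => absurd ⟨v, hv⟩ h⟩
  choose a b hab using key
  exact ⟨a, b, hab⟩

/-- `HeavyPath H u q c`: the maximal path of `H`-steps from `u` consists of the strings of the
list `q` (which starts with `u` unless it is empty), followed by `c`. -/
inductive HeavyPath (H : List α → List α → Prop) : List α → List (List α) → List α → Prop
  | nil (c : List α) (h : ∀ v, ¬ H c v) : HeavyPath H c [] c
  | cons {u v : List α} {q : List (List α)} {c : List α} (h : H u v) (hp : HeavyPath H v q c) :
      HeavyPath H u (u :: q) c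

theorem exists_heavyPath (hF : IsFamily S R) (u : List α) :
    ∃ q c, HeavyPath (Heavy S R o) u q c := by
  induction hn : u.length using Nat.strong_induction_on generalizing u with
  | _ n ih =>
    by_cases h : ∃ v, Heavy S R o u v
    · obtain ⟨v, hv⟩ := h
      have := (hF.length_lt_of_uses hv.1 hv.uses).2
      obtain ⟨q, c, hp⟩ := ih v.length (by omega) v rfl
      exact ⟨_, _, .cons hv hp⟩
    · exact ⟨_, _, .nil u (not_exists.1 h)⟩

theorem HeavyPath.of_append {H : List α → List α → Prop} {u c v : List α} {p q : List (List α)}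
    (h : HeavyPath H u (p ++ v :: q) c) : HeavyPath H v (v :: q) c := by
  induction p generalizing u with
  | nil =>
    cases h with
    | cons h hp => exact .cons h hp
  | cons k p ih =>
    cases h with
    | cons h hp => exact ih hp

theorem HeavyPath.eq_append {a b : List α → List α} (hab : IsContext S R o a b) {u c : List α}
    {q : List (List α)} (h : HeavyPath (Heavy S R o) u q c) :
    u = fronts a q ++ c ++ backs b q := by
  induction h with
  | nil c h => simp [fronts, backs]
  | @cons u v q c h hp ih =>
    conv_lhs => rw [(hab u v h).1, ih]
    simp [fronts, backs]

theorem HeavyPath.of_mem (hF : IsFamily S R) {u c : List α} {q : List (List α)}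
    (h : HeavyPath (Heavy S R o) u q c) (hu : u ∈ S) :
    (∀ v ∈ q ++ [c], v ∈ S ∧ Nat.log 2 (o v) = Nat.log 2 (o u) ∧
      Nat.log 2 v.length = Nat.log 2 u.length ∧ v.length ≤ u.length) ∧
    (∀ v ∈ q, ∃ v', Heavy S R o v v') ∧ (∀ v, ¬ Heavy S R o c v) ∧ (q ++ [c]).Nodup := by
  induction h with
  | nil c h => simpa using ⟨hu, h⟩
  | @cons u v q c h hp ih =>
    obtain ⟨ih1, ih2, ih3, ih4⟩ := ih (h.mem_right hF)
    have hl := (hF.length_lt_of_uses h.1 h.uses).2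
    have h1 := h.2.2.1
    have h2 := h.2.2.2
    refine ⟨?_, ?_, ih3, ?_⟩
    · intro x hx
      rw [List.cons_append, List.mem_cons] at hx
      obtain rfl | hx := hx
      · exact ⟨hu, rfl, rfl, le_rfl⟩
      · have := ih1 x hx
        exact ⟨this.1, by omega, by omega, by omega⟩
    · intro x hx
      rw [List.mem_cons] at hx
      obtain rfl | hx := hx
      · exact ⟨v, h⟩
      · exact ih2 x hx
    · rw [List.cons_append, List.nodup_cons]
      refine ⟨fun hx => ?_, ih4⟩
      have := ih1 u hx
      omega

open Classical in
/-- The occurrences of `v` that do not come from a heavy step. -/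
noncomputable def lightCount (S : Finset (List α)) (R : List α → Splitting α) (o : List α → ℕ)
    (v : List α) : ℕ :=
  o v - ∑ u ∈ S with Heavy S R o u v, o u

theorem sum_heavy_le (hF : IsFamily S R) (hM : IsMultiplicity S R w o) {v : List α} (hv : v ∈ S)
    {T : Finset (List α)} (hT : T ⊆ S) (hT' : ∀ u ∈ T, (R u).Uses v) : ∑ u ∈ T, o u ≤ o v :=
  hM.sum_le v hv T hT hT' fun h => (hF.length_lt_of_uses (hT h) (hT' v h)).2.false

theorem lightCount_add_le (hF : IsFamily S R) (hM : IsMultiplicity S R w o) {u v : List α}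
    (h : Heavy S R o u v) : lightCount S R o v + o u ≤ o v := by
  classical
  have h1 := sum_heavy_le hF hM (h.mem_right hF) (T := {u ∈ S | Heavy S R o u v})
    (Finset.filter_subset _ _) (fun u hu => (Finset.mem_filter.1 hu).2.uses)
  have h2 : o u ≤ ∑ u ∈ S with Heavy S R o u v, o u :=
    Finset.single_le_sum (f := o) (fun _ _ => Nat.zero_le _) (Finset.mem_filter.2 ⟨h.1, h⟩)
  rw [lightCount]
  convert (by omega : o v - (∑ u ∈ S with Heavy S R o u v, o u) + o u ≤ o v)

theorem le_lightCount (hF : IsFamily S R) (hM : IsMultiplicity S R w o) {u v : List α}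
    (hu : u ∈ S) (huv : (R u).Uses v) (h : ¬ Heavy S R o u v) : o u ≤ lightCount S R o v := by
  classical
  have hv := (hF.length_lt_of_uses hu huv).1
  have hnm : u ∉ {u ∈ S | Heavy S R o u v} := fun hh => h (Finset.mem_filter.1 hh).2
  have h1 := sum_heavy_le hF hM hv (T := insert u {u ∈ S | Heavy S R o u v}) (by
      rw [Finset.insert_subset_iff]; exact ⟨hu, Finset.filter_subset _ _⟩) (by
      intro z hz
      rcases Finset.mem_insert.1 hz with rfl | hz
      · exact huv
      · exact (Finset.mem_filter.1 hz).2.uses)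
  rw [Finset.sum_insert hnm] at h1
  rw [lightCount]
  convert (by omega : o u ≤ o v - (∑ u ∈ S with Heavy S R o u v, o u))

/-- The light parts hanging from a heavy path are disjoint, and so are the occurrences by which
the path is entered. -/
theorem HeavyPath.sum_le (hF : IsFamily S R) (hM : IsMultiplicity S R w o) {a b : List α → List α}
    (hab : IsContext S R o a b) {u c : List α} {q : List (List α)}
    (h : HeavyPath (Heavy S R o) u q c) :
    (q.map fun v => (a v ++ b v).length).sum ≤ u.length ∧
      (q.map (lightCount S R o)).sum + o u ≤ o c + lightCount S R o u := by
  induction h with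
  | nil c h => simp
  | @cons u v q c h hp ih =>
    obtain ⟨ih1, ih2⟩ := ih
    have h1 := congrArg List.length (hab u v h).1
    have h2 := lightCount_add_le hF hM h
    simp only [List.length_append, List.map_cons, List.sum_cons] at *
    omega

/-! ### Balancing -/

/-- The rank of the strings in the middle of the search tree of the heavy path through `v`. -/
def baseRank (w : List α) (o : List α → ℕ) (v : List α) : ℕ :=
  12 * (Nat.log 2 v.length + Nat.log 2 w.length - Nat.log 2 (o v))

/-- A bound for the rank of `v`, as a part of `u` after a light step. -/
def lightRank (w : List α) (o : List α → ℕ) (u v : List α) : ℕ :=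
  baseRank w o v + (Nat.log 2 (o v) - Nat.log 2 (o u)) + 4

theorem log_le (hF : IsFamily S R) (hM : IsMultiplicity S R w o) {v : List α} (hv : v ∈ S) :
    Nat.log 2 (o v) ≤ Nat.log 2 w.length := by
  have h1 := hM.mul_length_le v hv
  have h2 := List.length_pos_of_ne_nil (hF.ne_nil v hv)
  exact Nat.log_mono_right ((Nat.le_mul_of_pos_right _ h2).trans h1)

theorem lightRank_lt_baseRank (hF : IsFamily S R) (hM : IsMultiplicity S R w o) {u v : List α}
    (hu : u ∈ S) (huv : (R u).Uses v) (h : ¬ Heavy S R o u v) {e : ℕ}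
    (he : Nat.log 2 v.length + e ≤ Nat.log 2 u.length + 2) :
    lightRank w o u v + 2 * e + 2 ≤ baseRank w o u := by
  obtain ⟨h1, h2, h3⟩ := log_of_not_heavy hF hM hu huv h
  have h4 := log_le hF hM (hF.length_lt_of_uses hu huv).1
  rw [lightRank, baseRank, baseRank]
  omega

theorem log_add_le_of_mul_le {x e k m : ℕ} (hx : x ≠ 0) (h : x * 2 ^ k * 2 ^ e ≤ 2 ^ (k + m)) :
    Nat.log 2 x + e ≤ m := by
  have h1 := Nat.pow_log_le_self 2 hx
  have h2 : 2 ^ (Nat.log 2 x + k + e) ≤ 2 ^ (k + m) := by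
    rw [pow_add, pow_add]
    exact le_trans (Nat.mul_le_mul_right _ (Nat.mul_le_mul_right _ h1)) h
  have := (Nat.pow_le_pow_iff_right (by norm_num)).1 h2
  omega

/-- The strings for a heavy path: those of the search tree, the path itself, and its end. The
weight of a string of the path combines the length of its light part with the number of
occurrences by which it is entered, so that the costs of entering the path and of leaving it both
telescope. -/
theorem exists_strings_of_heavyPath (hF : IsFamily S R) (hM : IsMultiplicity S R w o)
    {u c : List α} {q : List (List α)} (hu : u ∈ S) (hp : HeavyPath (Heavy S R o) u q c) :
    ∃ F : Finset (List α × ℕ), F.card ≤ 7 * (q.length + 1) ∧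
      (∀ G, F ⊆ G → Has G [] 0 →
        (∀ x ∈ S, ∀ y, (R x).Uses y → ¬ Heavy S R o x y → Has G y (lightRank w o x y)) →
        ∀ p ∈ F, Derivable G p.1 p.2) ∧
      ∀ v ∈ q ++ [c], ∃ e ≤ Nat.log 2 v.length + 2, Has F v (baseRank w o v + e + 2) ∧
        ∀ x ∈ S, (R x).Uses v → ¬ Heavy S R o x v → e + Nat.log 2 (o x) ≤ Nat.log 2 (o v) + 2 := by
  classical
  obtain ⟨a, b, hab⟩ := exists_isContext (o := o) hF
  obtain ⟨hmem, hheavy, hend, -⟩ := hp.of_mem hF hu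
  set k := Nat.log 2 (o u) with hk
  set l := Nat.log 2 u.length with hl
  set E := baseRank w o u with hE
  have hEv : ∀ v ∈ q ++ [c], baseRank w o v = E := by
    intro v hv
    obtain ⟨-, h1, h2, -⟩ := hmem v hv
    rw [hE, baseRank, baseRank, h1, h2]
  let wt : List α → ℕ := fun v => (a v ++ b v).length * 2 ^ k + lightCount S R o v * 2 ^ l
  have hlightpart : ∀ v ∈ q, (R v).Uses (a v ++ b v) ∧ ¬ Heavy S R o v (a v ++ b v) ∧
      (a v = [] ∨ b v = []) := by
    intro v hv
    obtain ⟨v', hv'⟩ := hheavy v hv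
    obtain ⟨-, h1, h2, h3⟩ := hab v v' hv'
    exact ⟨h2, h3, h1⟩
  have hrk : ∀ v ∈ q, ∀ e, wt v * 2 ^ e ≤ 2 ^ (k + l + 2) →
      lightRank w o v (a v ++ b v) + 2 * e + 2 ≤ E := by
    intro v hv e he
    obtain ⟨h1, h2, -⟩ := hlightpart v hv
    have hv' := hmem v (by simp [hv])
    rw [← hEv v (by simp [hv])]
    refine lightRank_lt_baseRank hF hM hv'.1 h1 h2 ?_
    rw [hv'.2.2.1]
    refine log_add_le_of_mul_le (k := k) ?_ (le_trans (Nat.mul_le_mul_right _ ?_) he)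
    · have := hF.ne_nil _ (hF.length_lt_of_uses hv'.1 h1).1
      exact (List.length_pos_of_ne_nil this).ne'
    · exact Nat.le_add_right _ _
  have hsum : (q.map wt).sum * 2 ^ 0 ≤ 2 ^ (k + l + 2) := by
    obtain ⟨h1, h2⟩ := hp.sum_le hF hM hab
    have h3 : (q.map (lightCount S R o)).sum ≤ 2 ^ (k + 1) := by
      have : lightCount S R o u ≤ o u := Nat.sub_le _ _
      have h4 : o c < 2 ^ (Nat.log 2 (o c) + 1) := Nat.lt_pow_succ_log_self (by norm_num) _
      rw [(hmem c (by simp)).2.1] at h4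
      omega
    have h4 : u.length < 2 ^ (l + 1) := Nat.lt_pow_succ_log_self (by norm_num) _
    have h5 : (q.map wt).sum = (q.map fun v => (a v ++ b v).length).sum * 2 ^ k +
        (q.map (lightCount S R o)).sum * 2 ^ l := by
      simp only [wt]
      rw [List.sum_map_add, List.sum_map_mul_right, List.sum_map_mul_right]
    have h6 : (2 : ℕ) ^ (k + l + 2) = 2 ^ (l + 1) * 2 ^ k + 2 ^ (k + 1) * 2 ^ l := by ring
    rw [h5, h6, pow_zero, mul_one]
    exact Nat.add_le_add (Nat.mul_le_mul_right _ (by omega)) (Nat.mul_le_mul_right _ h3)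
  obtain ⟨F, hFc, hFd, hFs⟩ := exists_search_tree a b wt
    (fun v => lightRank w o v (a v ++ b v)) (k + l + 2) E q hrk 0 c [] hsum
  have hsuf : ∀ v ∈ q, ∃ e x y, wt v * 2 ^ e ≤ 2 ^ (k + l + 2) ∧ v = x ++ y ∧
      Has F x (E + e + 1) ∧ Has F y (E + e + 1) := by
    intro v hv
    obtain ⟨q1, q2, rfl⟩ := List.append_of_mem hv
    obtain ⟨e, he, h1, h2⟩ := hFs q1 v q2 rfl
    refine ⟨e, _, _, he, ?_, h1, h2⟩
    simpa using hp.of_append.eq_append hab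
  choose! e x y he hxy hx hy using hsuf
  let F1 : Finset (List α × ℕ) := q.toFinset.image fun v => (v, E + e v + 2)
  have hF1 : F1.card ≤ q.length := Finset.card_image_le.trans (List.toFinset_card_le q)
  refine ⟨insert (c, E) (F ∪ F1), ?_, ?_, ?_⟩
  · have h1 := Finset.card_insert_le (c, E) (F ∪ F1)
    have h2 := Finset.card_union_le F F1
    omega
  · intro G hG h0 hlight p hp'
    have hGF : F ⊆ G := (Finset.subset_union_left.trans (Finset.subset_insert _ _)).trans hG
    have hcG : Has G c E := ⟨_, le_rfl, hG (Finset.mem_insert_self _ _)⟩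
    have hcS := (hmem c (by simp)).1
    rcases Finset.mem_insert.1 hp' with rfl | hp'
    · -- all the parts of the end of the path are light
      have hpart : ∀ z, (R c).Uses z → Has G z (E - 1) ∧ E - 1 < E := by
        intro z hz
        have h2 := lightRank_lt_baseRank hF hM hcS hz (hend z) (e := 0)
          (by have := Nat.log_mono_right (b := 2) (hF.length_lt_of_uses hcS hz).2.le; omega)
        rw [hEv c (by simp)] at h2
        exact ⟨(hlight c hcS z hz (hend z)).mono subset_rfl (by omega), by omega⟩
      cases hr : R c with
      | symbol => exact Or.inr (Or.inl (hF.symbol c hcS hr))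
      | cat x y =>
        obtain ⟨hx, hlt⟩ := hpart x (by simp [hr, Splitting.Uses])
        obtain ⟨hy, -⟩ := hpart y (by simp [hr, Splitting.Uses])
        rw [(hF.cat c hcS x y hr).2.2]
        exact Derivable.of_cat hx hy hlt
      | pow x t =>
        obtain ⟨hx, hlt⟩ := hpart x (by simp [hr, Splitting.Uses])
        exact Or.inr (Or.inr ⟨_, hlt, Or.inr ⟨x, t, hx, (hF.pow c hcS x t hr).2.2⟩⟩)
    · rcases Finset.mem_union.1 hp' with hp' | hp'
      · refine (hFd G hGF h0 ?_ hcG (h0.mono subset_rfl (by omega))).1 p hp'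
        intro v hv
        obtain ⟨h1, h2, h3⟩ := hlightpart v hv
        have h4 := hlight v (hmem v (by simp [hv])).1 _ h1 h2
        obtain h | h := h3 <;> rw [h] at h4 ⊢ <;> simp only [List.nil_append, List.append_nil] at *
        · exact ⟨h0.mono subset_rfl (by omega), h4⟩
        · exact ⟨h4, h0.mono subset_rfl (by omega)⟩
      · obtain ⟨v, hv, rfl⟩ := Finset.mem_image.1 hp'
        rw [List.mem_toFinset] at hv
        have := Derivable.of_cat (r := E + e v + 2) ((hx v hv).mono hGF le_rfl)
          ((hy v hv).mono hGF le_rfl) (by omega)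
        rwa [← hxy v hv] at this
  · intro v hv
    rw [hEv v hv]
    rcases List.mem_append.1 hv with hvq | hvc
    · obtain ⟨hvS, hk', hl', -⟩ := hmem v hv
      have h1 := hlightpart v hvq
      refine ⟨e v, ?_, ⟨_, le_rfl, ?_⟩, ?_⟩
      · have := log_add_le_of_mul_le (x := (a v ++ b v).length) (e := e v) (k := k) (m := l + 2)
          (List.length_pos_of_ne_nil (hF.ne_nil _ (hF.length_lt_of_uses hvS h1.1).1)).ne'
          (le_trans (Nat.mul_le_mul_right _ (Nat.le_add_right _ _)) (he v hvq))
        omega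
      · refine Finset.mem_insert_of_mem (Finset.mem_union_right _ (Finset.mem_image.2 ⟨v, ?_, rfl⟩))
        simpa using hvq
      · intro x hxS hxv hxh
        have h2 := le_lightCount hF hM hxS hxv hxh
        have h3 := hM.pos x hxS
        have h4 : Nat.log 2 (o x) ≤ Nat.log 2 (lightCount S R o v) := Nat.log_mono_right h2
        have := log_add_le_of_mul_le (x := lightCount S R o v) (e := e v) (k := l) (m := k + 2)
          (by omega) (le_trans (Nat.mul_le_mul_right _ (Nat.le_add_left _ _))
            ((he v hvq).trans (le_of_eq (by ring))))
        omega
    · obtain rfl : v = c := by simpa using hvc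
      refine ⟨0, by omega, ⟨E, by omega, Finset.mem_insert_self _ _⟩, fun x hxS hxv _ => ?_⟩
      have : Nat.log 2 (o x) ≤ Nat.log 2 (o v) := Nat.log_mono_right (le_of_uses hF hM hxS hxv)
      omega

theorem HeavyPath.mem_iff (hF : IsFamily S R) {u c v : List α} {q : List (List α)}
    (h : HeavyPath (Heavy S R o) u q c) :
    v ∈ q ++ [c] ↔ Relation.ReflTransGen (Heavy S R o) u v := by
  induction h with
  | nil c h =>
    simp only [List.nil_append, List.mem_singleton]
    refine ⟨fun hv => hv ▸ .refl, fun hv => ?_⟩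
    rcases hv.cases_head with h' | ⟨x, hx, -⟩
    · exact h'.symm
    · exact absurd hx (h x)
  | @cons u x q c h hp ih =>
    rw [List.cons_append, List.mem_cons, ih]
    constructor
    · rintro (rfl | hv)
      · exact .refl
      · exact .head h hv
    · intro hv
      rcases hv.cases_head with rfl | ⟨y, hy, hv⟩
      · exact Or.inl rfl
      · obtain rfl := hy.right_unique hF h
        exact Or.inr hv

theorem exists_head (hF : IsFamily S R) (hM : IsMultiplicity S R w o) {v : List α} (hv : v ∈ S) :
    ∃ u ∈ S, (∀ x, ¬ Heavy S R o x u) ∧ Relation.ReflTransGen (Heavy S R o) u v := by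
  induction hn : w.length - v.length using Nat.strong_induction_on generalizing v with
  | _ n ih =>
    by_cases h : ∃ x, Heavy S R o x v
    · obtain ⟨x, hx⟩ := h
      have h1 := (hF.length_lt_of_uses hx.1 hx.uses).2
      have h2 := hM.mul_length_le x hx.1
      have h3 := Nat.le_mul_of_pos_left x.length (hM.pos x hx.1)
      obtain ⟨u, hu, hu', huv⟩ := ih (w.length - x.length) (by omega) hx.1 rfl
      exact ⟨u, hu, hu', huv.tail hx⟩
    · exact ⟨v, hv, not_exists.1 h, .refl⟩

theorem head_unique (hF : IsFamily S R) (hM : IsMultiplicity S R w o) {u u' v : List α}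
    (hu : ∀ x, ¬ Heavy S R o x u) (hu' : ∀ x, ¬ Heavy S R o x u')
    (h : Relation.ReflTransGen (Heavy S R o) u v)
    (h' : Relation.ReflTransGen (Heavy S R o) u' v) : u = u' := by
  have hright : Relator.RightUnique (Function.swap (Heavy S R o)) :=
    fun _ _ _ hb hc => Heavy.left_unique hF hM hb hc
  rcases Relation.ReflTransGen.total_of_right_unique hright h.swap h'.swap with h1 | h1
  · rcases h1.swap.cases_tail with h2 | ⟨x, -, hx⟩
    · exact h2
    · exact absurd hx (hu x)
  · rcases h1.swap.cases_tail with h2 | ⟨x, -, hx⟩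
    · exact h2.symm
    · exact absurd hx (hu' x)

/-- The balancing theorem for run-length grammars, with strings in place of variables: the new
strings are closed under a derivation relation of logarithmic depth. -/
theorem exists_derivable (hF : IsFamily S R) (hM : IsMultiplicity S R w o) (hw : w ∈ S) :
    ∃ F : Finset (List α × ℕ), (∀ p ∈ F, Derivable F p.1 p.2) ∧ F.card ≤ 7 * S.card + 1 ∧
      Has F w (25 * Nat.log 2 w.length + 4) := by
  classical
  choose q c hp using fun u => exists_heavyPath (o := o) hF u
  have key : ∀ u, ∃ F : Finset (List α × ℕ), u ∈ S → F.card ≤ 7 * ((q u).length + 1) ∧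
      (∀ G, F ⊆ G → Has G [] 0 →
        (∀ x ∈ S, ∀ y, (R x).Uses y → ¬ Heavy S R o x y → Has G y (lightRank w o x y)) →
        ∀ p ∈ F, Derivable G p.1 p.2) ∧
      ∀ v ∈ q u ++ [c u], ∃ e ≤ Nat.log 2 v.length + 2, Has F v (baseRank w o v + e + 2) ∧
        ∀ x ∈ S, (R x).Uses v → ¬ Heavy S R o x v →
          e + Nat.log 2 (o x) ≤ Nat.log 2 (o v) + 2 := by
    intro u
    by_cases hu : u ∈ S
    · obtain ⟨F, hF'⟩ := exists_strings_of_heavyPath hF hM hu (hp u)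
      exact ⟨F, fun _ => hF'⟩
    · exact ⟨∅, fun h => absurd h hu⟩
  choose F hFu using key
  let heads : Finset (List α) := {u ∈ S | ∀ x, ¬ Heavy S R o x u}
  have hheads : ∀ u ∈ heads, u ∈ S ∧ ∀ x, ¬ Heavy S R o x u := fun u hu => Finset.mem_filter.1 hu
  let G : Finset (List α × ℕ) := insert ([], 0) (heads.biUnion F)
  have hsub : ∀ u ∈ heads, F u ⊆ G := fun u hu =>
    (Finset.subset_biUnion_of_mem F hu).trans (Finset.subset_insert _ _)
  have hpath : ∀ v ∈ S, ∃ e ≤ Nat.log 2 v.length + 2, Has G v (baseRank w o v + e + 2) ∧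
      ∀ x ∈ S, (R x).Uses v → ¬ Heavy S R o x v →
        e + Nat.log 2 (o x) ≤ Nat.log 2 (o v) + 2 := by
    intro v hv
    obtain ⟨u, hu, hu', huv⟩ := exists_head hF hM hv
    obtain ⟨e, he, h1, h2⟩ := (hFu u hu).2.2 v (((hp u).mem_iff hF).2 huv)
    exact ⟨e, he, h1.mono (hsub u (Finset.mem_filter.2 ⟨hu, hu'⟩)) le_rfl, h2⟩
  refine ⟨G, ?_, ?_, ?_⟩
  · have h0 : Has G [] 0 := ⟨0, le_rfl, Finset.mem_insert_self _ _⟩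
    intro p hpG
    rcases Finset.mem_insert.1 hpG with rfl | hpG
    · exact Or.inl rfl
    · obtain ⟨u, hu, hpu⟩ := Finset.mem_biUnion.1 hpG
      refine (hFu u (hheads u hu).1).2.1 G (hsub u hu) h0 ?_ p hpu
      intro x hx y hxy hh
      obtain ⟨e, -, h1, h2⟩ := hpath y (hF.length_lt_of_uses hx hxy).1
      have h3 := h2 x hx hxy hh
      have h4 := (log_of_not_heavy hF hM hx hxy hh).1
      refine h1.mono subset_rfl ?_
      rw [lightRank]
      omega
  · refine (Finset.card_insert_le _ _).trans (Nat.add_le_add_right ?_ 1)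
    calc (heads.biUnion F).card ≤ ∑ u ∈ heads, 7 * ((q u).length + 1) :=
          Finset.card_biUnion_le.trans
            (Finset.sum_le_sum fun u hu => (hFu u (hheads u hu).1).1)
      _ = 7 * ∑ u ∈ heads, (q u ++ [c u]).toFinset.card := by
          rw [Finset.mul_sum]
          refine Finset.sum_congr rfl fun u hu => ?_
          rw [List.toFinset_card_of_nodup ((hp u).of_mem hF (hheads u hu).1).2.2.2]
          simp
      _ = 7 * (heads.biUnion fun u => (q u ++ [c u]).toFinset).card := by
          rw [Finset.card_biUnion]
          intro u hu u' hu' hne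
          rw [Function.onFun, Finset.disjoint_left]
          intro v hv hv'
          rw [List.mem_toFinset] at hv hv'
          exact hne (head_unique hF hM (hheads u hu).2 (hheads u' hu').2
            (((hp u).mem_iff hF).1 hv) (((hp u').mem_iff hF).1 hv'))
      _ ≤ 7 * S.card := by
          refine Nat.mul_le_mul_left _ (Finset.card_le_card ?_)
          intro v hv
          obtain ⟨u, hu, hv⟩ := Finset.mem_biUnion.1 hv
          rw [List.mem_toFinset] at hv
          exact (((hp u).of_mem hF (hheads u hu).1).1 v hv).1
  · obtain ⟨e, he, h1, -⟩ := hpath w hw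
    refine h1.mono subset_rfl ?_
    rw [baseRank]
    omega

end

/-- A set of nonempty substrings of `w`, containing `w`, in which every string is a symbol or has
the form `x ^ t y` with strings `x` and `y` of smaller rank in the set. -/
structure IsBalanced (w : List α) (S : Finset (List α)) (ρ : List α → ℕ) : Prop where
  mem : w ∈ S
  ne_nil : ∀ s ∈ S, s ≠ []
  isInfix : ∀ s ∈ S, s <:+: w
  split : ∀ s ∈ S, (∃ a, s = [a]) ∨ ∃ x ∈ S, ∃ y ∈ S, ∃ t, 1 ≤ t ∧
    s = (List.replicate t x).flatten ++ y ∧ ρ x < ρ s ∧ ρ y < ρ s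

/-- Strings are kept with their smallest rank only: a derivation with an empty part, or a power
with exponent 1, would show that this rank is not the smallest one. -/
theorem exists_isBalanced_of_derivable {w : List α} (hw : w ≠ []) {r : ℕ}
    {F : Finset (List α × ℕ)} (hF : ∀ p ∈ F, Derivable F p.1 p.2) (hFw : Has F w r) :
    ∃ S ρ, IsBalanced w S ρ ∧ S.card ≤ F.card ∧ ρ w ≤ r := by
  classical
  let S : Finset (List α) := (F.image Prod.fst).filter fun s => s ≠ [] ∧ s <:+: w
  let ρ : List α → ℕ := fun s => sInf {r | (s, r) ∈ F}
  have hS : ∀ {s r}, Has F s r → s ≠ [] → s <:+: w → s ∈ S ∧ ρ s ≤ r := by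
    rintro s r ⟨r', hr, hs⟩ h0 hi
    exact ⟨Finset.mem_filter.2 ⟨Finset.mem_image_of_mem Prod.fst hs, h0, hi⟩,
      (Nat.sInf_le (s := {r | (s, r) ∈ F}) hs).trans hr⟩
  have hS' : ∀ s ∈ S, s ≠ [] ∧ s <:+: w ∧ (s, ρ s) ∈ F := by
    intro s hs
    obtain ⟨hs, h0, hi⟩ := Finset.mem_filter.1 hs
    obtain ⟨⟨s', r⟩, hp, rfl⟩ := Finset.mem_image.1 hs
    exact ⟨h0, hi, Nat.sInf_mem (s := {r | (s', r) ∈ F}) ⟨r, hp⟩⟩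
  have hmin : ∀ s ∈ S, ∀ m < ρ s, ¬ Has F s m := fun s hs m hm h =>
    absurd (hS h (hS' s hs).1 (hS' s hs).2.1).2 (by omega)
  refine ⟨S, ρ, ⟨(hS hFw hw List.infix_rfl).1, fun s hs => (hS' s hs).1,
    fun s hs => (hS' s hs).2.1, ?_⟩, ?_, (hS hFw hw List.infix_rfl).2⟩
  · intro s hs
    obtain ⟨h0, hi, hmem⟩ := hS' s hs
    obtain h | h | ⟨m, hm, ⟨x, y, hx, hy, hxy⟩ | ⟨x, t, hx, hxt⟩⟩ := hF _ hmem
    · exact absurd h h0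
    · exact Or.inl h
    · dsimp only at hxy hm
      have hx0 : x ≠ [] := by
        rintro rfl
        rw [List.nil_append] at hxy
        exact hmin s hs m hm (hxy ▸ hy)
      have hy0 : y ≠ [] := by
        rintro rfl
        rw [List.append_nil] at hxy
        exact hmin s hs m hm (hxy ▸ hx)
      obtain ⟨h1, h2⟩ := hS hx hx0 (List.IsInfix.trans ⟨[], y, by simp [hxy]⟩ hi)
      obtain ⟨h3, h4⟩ := hS hy hy0 (List.IsInfix.trans ⟨x, [], by simp [hxy]⟩ hi)
      exact Or.inr ⟨x, h1, y, h3, 1, le_rfl, by simpa using hxy, by omega, by omega⟩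
    · dsimp only at hxt hm
      obtain _ | _ | t := t
      · exact absurd (by simpa using hxt) h0
      · refine absurd ?_ (hmin s hs m hm)
        have : s = x := by simpa using hxt
        exact this ▸ hx
      · have hx0 : x ≠ [] := by
          rintro rfl
          exact h0 (by simpa using hxt)
        have hxt' : s = (List.replicate (t + 1) x).flatten ++ x := by
          rw [hxt, List.replicate_succ']
          simp
        obtain ⟨h1, h2⟩ := hS hx hx0
          (List.IsInfix.trans ⟨(List.replicate (t + 1) x).flatten, [], by simp [hxt']⟩ hi)
        exact Or.inr ⟨x, h1, x, h1, t + 1, by omega, hxt', by omega, by omega⟩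
  · exact (Finset.card_filter_le _ _).trans Finset.card_image_le

/-- Balancing: the strings of a smallest grammar give `O(g_rl)` strings of logarithmic rank. -/
theorem exists_isBalanced {w : List α} (hw : w ≠ []) :
    ∃ S ρ, IsBalanced w S ρ ∧ S.card ≤ 8 * grl w ∧ ρ w ≤ 25 * Nat.log 2 w.length + 4 := by
  obtain ⟨G, hG, hsize⟩ := RLSLP.exists_size_eq_grl w hw
  obtain ⟨S, R, hF, hmem, hcard⟩ := exists_isFamily G
  rw [hG] at hmem
  obtain ⟨S', o, hS', hw', hF', hM⟩ := exists_isMultiplicity hF hmem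
  obtain ⟨F, h1, h2, h3⟩ := exists_derivable hF' hM hw'
  obtain ⟨T, ρ, hT, h4, h5⟩ := exists_isBalanced_of_derivable hw h1 h3
  refine ⟨T, ρ, hT, ?_, h5⟩
  have h6 := Finset.card_le_card hS'
  have h7 : 0 < S'.card := Finset.card_pos.2 ⟨w, hw'⟩
  omega

end BalancedRLSLP

namespace RangeMin

/-! ### Leftmost minima -/

/-- `k` is the leftmost position of the minimum of `v` on `[a, b)`. -/
def LeftmostMin (v : ℕ → ℕ) (a b k : ℕ) : Prop :=
  a ≤ k ∧ k < b ∧ ∀ m, a ≤ m → m < b → v k ≤ v m ∧ (m < k → v k < v m)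

variable {v : ℕ → ℕ} {a b c k l : ℕ}

theorem LeftmostMin.append_left (h : LeftmostMin v a b k) (h' : LeftmostMin v b c l)
    (hv : v k ≤ v l) : LeftmostMin v a c k := by
  obtain ⟨h1, h2, h3⟩ := h
  obtain ⟨h4, h5, h6⟩ := h'
  refine ⟨h1, by omega, fun m hm hm' => ?_⟩
  by_cases hmb : m < b
  · exact h3 m hm hmb
  · exact ⟨hv.trans (h6 m (by omega) hm').1, fun h => by omega⟩

theorem LeftmostMin.append_right (h : LeftmostMin v a b k) (h' : LeftmostMin v b c l)
    (hv : v l < v k) : LeftmostMin v a c l := by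
  obtain ⟨h1, h2, h3⟩ := h
  obtain ⟨h4, h5, h6⟩ := h'
  refine ⟨by omega, h5, fun m hm hm' => ?_⟩
  by_cases hmb : m < b
  · have := (h3 m hm hmb).1
    exact ⟨by omega, fun _ => by omega⟩
  · exact h6 m (by omega) hm'

theorem LeftmostMin.singleton (v : ℕ → ℕ) (a : ℕ) : LeftmostMin v a (a + 1) a := by
  refine ⟨le_rfl, by omega, fun m h h' => ?_⟩
  obtain rfl : m = a := by omega
  exact ⟨le_rfl, fun h => by omega⟩

theorem exists_leftmostMin (v : ℕ → ℕ) (a d : ℕ) : ∃ k, LeftmostMin v a (a + d + 1) k := by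
  induction d with
  | zero => exact ⟨a, .singleton v a⟩
  | succ d ih =>
    obtain ⟨k, hk⟩ := ih
    have h := LeftmostMin.singleton v (a + d + 1)
    rcases le_or_gt (v k) (v (a + d + 1)) with h' | h'
    · exact ⟨k, hk.append_left h h'⟩
    · exact ⟨_, hk.append_right h h'⟩

/-- The leftmost minimum of consecutive copies is in the first copy. -/
theorem leftmostMin_copies {o m x y q q' : ℕ} (hq : q < q')
    (h : ∀ p, p < q' → LeftmostMin v (o + p * m) (o + (p + 1) * m) (o + p * m + x) ∧
      v (o + p * m + x) = y) : LeftmostMin v (o + q * m) (o + q' * m) (o + q * m + x) := by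
  induction q', hq using Nat.le_induction with
  | base => exact (h q (by omega)).1
  | succ q' hq ih =>
    refine (ih fun p hp => h p (by omega)).append_left (h q' (by omega)).1 ?_
    rw [(h q (by omega)).2, (h q' (by omega)).2]

/-- `y` and `k` are the minimum and its leftmost position on `[a, b)`. If this interval is empty,
`y` is `n`, a number that exceeds all values of `v`. -/
def Best (v : ℕ → ℕ) (n a b y k : ℕ) : Prop :=
  (a = b ∧ y = n) ∨ (LeftmostMin v a b k ∧ y = v k)

variable {n y : ℕ}

theorem Best.cons_new (h : Best v n b c y k) (h' : LeftmostMin v a b l) (hy : v l ≤ y) :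
    Best v n a c (v l) l := by
  obtain ⟨rfl, rfl⟩ | ⟨h1, rfl⟩ := h
  · exact Or.inr ⟨h', rfl⟩
  · exact Or.inr ⟨h'.append_left h1 hy, rfl⟩

theorem Best.cons_old (h : Best v n b c y k) (h' : LeftmostMin v a b l) (hn : v l < n)
    (hy : y < v l) : Best v n a c y k := by
  obtain ⟨rfl, rfl⟩ | ⟨h1, rfl⟩ := h
  · omega
  · exact Or.inr ⟨h'.append_right h1 hy, rfl⟩

theorem Best.snoc_new (h : Best v n a b y k) (h' : LeftmostMin v b c l) (hy : v l < y) :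
    Best v n a c (v l) l := by
  obtain ⟨rfl, rfl⟩ | ⟨h1, rfl⟩ := h
  · exact Or.inr ⟨h', rfl⟩
  · exact Or.inr ⟨h1.append_right h' hy, rfl⟩

theorem Best.snoc_old (h : Best v n a b y k) (h' : LeftmostMin v b c l) (hn : v l < n)
    (hy : y ≤ v l) : Best v n a c y k := by
  obtain ⟨rfl, rfl⟩ | ⟨h1, rfl⟩ := h
  · omega
  · exact Or.inr ⟨h1.append_left h' hy, rfl⟩

/-! ### Stored strings -/

/-- `Stored mem v p o len r`: the eight words of `mem` at `p` describe the values of `v` on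
`[o, o + len)`, by a binary tree of height `r`. For a single value the first word is 0 and the
fifth one is the value. Otherwise the values are those of `t` copies of a first part of length
`m > 0`, and of a second part; the words are `m`, `t * m`, the addresses of the two parts, and the
minimum of each part followed by its leftmost position in that part. -/
inductive Stored (mem : List ℕ) (v : ℕ → ℕ) : ℕ → ℕ → ℕ → ℕ → Prop
  | leaf {p o r : ℕ} (f : ℕ → ℕ) (hmem : ∀ c < 8, mem[p + c]? = some (f c)) (h0 : f 0 = 0)
      (h4 : f 4 = v o) : Stored mem v p o 1 r
  | node {p o l r t : ℕ} (f : ℕ → ℕ) (hmem : ∀ c < 8, mem[p + c]? = some (f c)) (h0 : 0 < f 0)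
      (h1 : f 1 = t * f 0)
      (hx : ∀ q < t, Stored mem v (f 2) (o + q * f 0) (f 0) r)
      (hxm : ∀ q < t, LeftmostMin v (o + q * f 0) (o + (q + 1) * f 0) (o + q * f 0 + f 5) ∧
        v (o + q * f 0 + f 5) = f 4)
      (hy : Stored mem v (f 3) (o + t * f 0) l r)
      (hym : LeftmostMin v (o + t * f 0) (o + t * f 0 + l) (o + t * f 0 + f 7) ∧
        v (o + t * f 0 + f 7) = f 6) : Stored mem v p o (t * f 0 + l) (r + 1)

end RangeMin

namespace WordRAM

/-! ### Rules for the execution of programs -/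

/-- Started at `pc` with registers `ρ` and memory `mem`, the program halts after at most `T` steps
with the memory in its original state and a value with the property `Q` in register 0. -/
def Halts (W : ℕ) (P : Program) (mem : List ℕ) (Q : ℕ → Prop) (pc : ℕ) (ρ : ℕ → ℕ) (T : ℕ) :
    Prop :=
  ∃ t ≤ T, ∃ s, run W P t ⟨pc, ρ, mem⟩ = some s ∧ P[s.pc]? = some .halt ∧ Q (s.reg 0) ∧
    s.mem = mem

namespace Halts

variable {W : ℕ} {P : Program} {mem : List ℕ} {Q : ℕ → Prop} {pc T d x y l a b : ℕ} {ρ : ℕ → ℕ}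

theorem mono {T' : ℕ} (h : Halts W P mem Q pc ρ T) (hT : T ≤ T') : Halts W P mem Q pc ρ T' :=
  let ⟨t, ht, h⟩ := h
  ⟨t, ht.trans hT, h⟩

theorem halt (h : P[pc]? = some .halt) (hQ : Q (ρ 0)) : Halts W P mem Q pc ρ T :=
  ⟨0, Nat.zero_le _, _, rfl, h, hQ, rfl⟩

theorem of_exec {i : Instr} {pc' : ℕ} {ρ' : ℕ → ℕ} (h : P[pc]? = some i)
    (hi : i.exec W ⟨pc, ρ, mem⟩ = some ⟨pc', ρ', mem⟩) (H : Halts W P mem Q pc' ρ' T) :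
    Halts W P mem Q pc ρ (T + 1) := by
  obtain ⟨t, ht, s, hs, hs'⟩ := H
  refine ⟨t + 1, by omega, s, ?_, hs'⟩
  simp [run, step, h, hi, hs]

theorem const {c : ℕ} (h : P[pc]? = some (.const d c)) (hc : c < 2 ^ W)
    (H : Halts W P mem Q (pc + 1) (Function.update ρ d c) T) : Halts W P mem Q pc ρ (T + 1) :=
  of_exec h (by rw [Instr.exec, Nat.mod_eq_of_lt hc]) H

theorem move (h : P[pc]? = some (.move d x)) (hx : ρ x = a)
    (H : Halts W P mem Q (pc + 1) (Function.update ρ d a) T) : Halts W P mem Q pc ρ (T + 1) :=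
  of_exec h (by simp [Instr.exec, hx]) H

theorem add (h : P[pc]? = some (.arith .add d x y)) (hx : ρ x = a) (hy : ρ y = b)
    (hab : a + b < 2 ^ W) (H : Halts W P mem Q (pc + 1) (Function.update ρ d (a + b)) T) :
    Halts W P mem Q pc ρ (T + 1) :=
  of_exec h (by simp [Instr.exec, hx, hy, Op.eval, Nat.mod_eq_of_lt hab]) H

theorem sub (h : P[pc]? = some (.arith .sub d x y)) (hx : ρ x = a) (hy : ρ y = b)
    (hb : b ≤ a) (ha : a < 2 ^ W)
    (H : Halts W P mem Q (pc + 1) (Function.update ρ d (a - b)) T) :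
    Halts W P mem Q pc ρ (T + 1) := by
  refine of_exec h ?_ H
  have : a + (2 ^ W - b) = a - b + 2 ^ W := by omega
  simp [Instr.exec, hx, hy, Op.eval, this, Nat.mod_eq_of_lt (by omega : a - b < 2 ^ W)]

theorem mul (h : P[pc]? = some (.arith .mul d x y)) (hx : ρ x = a) (hy : ρ y = b)
    (hab : a * b < 2 ^ W) (H : Halts W P mem Q (pc + 1) (Function.update ρ d (a * b)) T) :
    Halts W P mem Q pc ρ (T + 1) :=
  of_exec h (by simp [Instr.exec, hx, hy, Op.eval, Nat.mod_eq_of_lt hab]) H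

theorem div (h : P[pc]? = some (.arith .div d x y)) (hx : ρ x = a) (hy : ρ y = b)
    (H : Halts W P mem Q (pc + 1) (Function.update ρ d (a / b)) T) :
    Halts W P mem Q pc ρ (T + 1) :=
  of_exec h (by simp [Instr.exec, hx, hy, Op.eval]) H

theorem load (h : P[pc]? = some (.load d x)) (hx : ρ x = a) (ha : mem[a]? = some b)
    (H : Halts W P mem Q (pc + 1) (Function.update ρ d b) T) : Halts W P mem Q pc ρ (T + 1) :=
  of_exec h (by simp [Instr.exec, hx, ha]) H

theorem jump (h : P[pc]? = some (.jump l)) (H : Halts W P mem Q l ρ T) :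
    Halts W P mem Q pc ρ (T + 1) :=
  of_exec h rfl H

theorem jumpLt_pos (h : P[pc]? = some (.jumpLt x y l)) (hx : ρ x = a) (hy : ρ y = b)
    (hab : a < b) (H : Halts W P mem Q l ρ T) : Halts W P mem Q pc ρ (T + 1) :=
  of_exec h (by simp [Instr.exec, hx, hy, hab]) H

theorem jumpLt_neg (h : P[pc]? = some (.jumpLt x y l)) (hx : ρ x = a) (hy : ρ y = b)
    (hab : b ≤ a) (H : Halts W P mem Q (pc + 1) ρ T) : Halts W P mem Q pc ρ (T + 1) :=
  of_exec h (by simp [Instr.exec, hx, hy, hab.not_gt]) H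

theorem jumpEq_pos (h : P[pc]? = some (.jumpEq x y l)) (hx : ρ x = a) (hy : ρ y = b)
    (hab : a = b) (H : Halts W P mem Q l ρ T) : Halts W P mem Q pc ρ (T + 1) :=
  of_exec h (by simp [Instr.exec, hx, hy, hab]) H

theorem jumpEq_neg (h : P[pc]? = some (.jumpEq x y l)) (hx : ρ x = a) (hy : ρ y = b)
    (hab : a ≠ b) (H : Halts W P mem Q (pc + 1) ρ T) : Halts W P mem Q pc ρ (T + 1) :=
  of_exec h (by simp [Instr.exec, hx, hy, hab]) H

end Halts

end WordRAM

namespace RangeMin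

open WordRAM

/-! ### The query program -/

/-- The query program. Words 0 and 1 of the memory are the address of the stored string and a
number that exceeds all values.

Register 2 is the address of the current string and register 3 its position in the whole string;
registers 0 and 1 are the ends of the query, relative to that position and counted from 0.
Registers 4 and 5 are the constants 1 and 0. Register 6 is 0 while the current string contains
the whole query, 1 while the query extends to the right of it, and 2 while the query extends to
the left of it. Registers 7 and 8 are the minimum found so far and its leftmost position.
Registers 10 to 17 are the words stored for the current string, and registers 20 to 22 are the
position of the string that contains the right end of the query, its address, and the right end
relative to it.

The numbers in the comments are the addresses of the instructions that follow them. -/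
def query : Program := [
  .const 4 1,
  .arith .sub 0 0 4,
  .arith .sub 1 1 4,
  .load 2 5,
  .load 7 4,
  -- 5: load the words of the current string
  .load 10 2,
  .arith .add 9 2 4,
  .load 11 9,
  .arith .add 9 9 4,
  .load 12 9,
  .arith .add 9 9 4,
  .load 13 9,
  .arith .add 9 9 4,
  .load 14 9,
  .arith .add 9 9 4,
  .load 15 9,
  .arith .add 9 9 4,
  .load 16 9,
  .arith .add 9 9 4,
  .load 17 9,
  .jumpEq 10 5 86,
  .jumpEq 6 4 53,
  .jumpLt 4 6 71,
  -- 23: the current string contains the query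
  .jumpLt 0 11 29,
  .arith .add 3 3 11,
  .arith .sub 0 0 11,
  .arith .sub 1 1 11,
  .move 2 13,
  .jump 5,
  .arith .div 18 0 10,
  .arith .mul 19 18 10,
  .jumpLt 1 11 35,
  .move 20 11,
  .move 21 13,
  .jump 39,
  .arith .div 20 1 10,
  .jumpEq 18 20 48,
  .arith .mul 20 20 10,
  .move 21 12,
  -- 39: the ends of the query are in different parts; take the minimum of the parts in between
  .arith .add 23 19 10,
  .jumpEq 23 20 44,
  .move 7 14,
  .arith .add 8 3 23,
  .arith .add 8 8 15,
  .arith .sub 22 1 20,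
  .arith .add 20 3 20,
  .move 6 4,
  .jump 49,
  .arith .sub 1 1 19,
  -- 49: go to the copy of the first part that contains the left end
  .arith .sub 0 0 19,
  .arith .add 3 3 19,
  .move 2 12,
  .jump 5,
  -- 53: the query consists of a suffix of the current string and of positions seen before
  .jumpLt 0 11 58,
  .arith .add 3 3 11,
  .arith .sub 0 0 11,
  .move 2 13,
  .jump 5,
  .jumpLt 7 16 62,
  .move 7 16,
  .arith .add 8 3 11,
  .arith .add 8 8 17,
  .arith .div 18 0 10,
  .arith .mul 19 18 10,
  .arith .add 23 19 10,
  .jumpEq 23 11 49,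
  .jumpLt 7 14 49,
  .move 7 14,
  .arith .add 8 3 23,
  .arith .add 8 8 15,
  .jump 49,
  -- 71: the query consists of positions seen before and of a prefix of the current string
  .jumpLt 1 11 75,
  .move 19 11,
  .move 2 13,
  .jump 78,
  .arith .div 19 1 10,
  .arith .mul 19 19 10,
  .move 2 12,
  .jumpEq 19 5 83,
  .jumpLt 14 7 81,
  .jump 83,
  .move 7 14,
  .arith .add 8 3 15,
  .arith .sub 1 1 19,
  .arith .add 3 3 19,
  .jump 5,
  -- 86: the current string is a single symbol
  .jumpEq 6 4 90,
  .jumpLt 4 6 98,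
  .arith .add 0 3 4,
  .halt,
  .jumpLt 7 14 93,
  .move 7 14,
  .move 8 3,
  .move 2 21,
  .move 3 20,
  .move 1 22,
  .arith .add 6 4 4,
  .jump 5,
  .jumpLt 14 7 100,
  .jump 102,
  .move 7 14,
  .move 8 3,
  .arith .add 0 8 4,
  .halt]

/-- `z` is a position, counted from 1, of the leftmost minimum of `v` on `[a, b)`. -/
def IsAnswer (v : ℕ → ℕ) (a b z : ℕ) : Prop :=
  ∃ k, z = k + 1 ∧ LeftmostMin v a b k

variable {W : ℕ} {mem : List ℕ} {Q : ℕ → Prop} {v : ℕ → ℕ} {n : ℕ} {ρ : ℕ → ℕ} {T : ℕ}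

/-- Addresses, positions and values fit into machine words. -/
structure Fits (W : ℕ) (mem : List ℕ) (v : ℕ → ℕ) (n : ℕ) : Prop where
  length_le : mem.length ≤ 2 ^ W
  lt : n + 2 < 2 ^ W
  val_lt : ∀ p < n, v p < n

/-- The eight words of the current string are loaded; the registers outside of 9, …, 17 are kept. -/
theorem halts_load {p : ℕ} {f : ℕ → ℕ} (hf : Fits W mem v n)
    (hmem : ∀ c < 8, mem[p + c]? = some (f c)) (h2 : ρ 2 = p) (h4 : ρ 4 = 1)
    (H : ∀ ρ', (∀ r, r < 9 ∨ 17 < r → ρ' r = ρ r) → (∀ c < 8, ρ' (10 + c) = f c) →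
      Halts W query mem Q 20 ρ' T) : Halts W query mem Q 5 ρ (T + 15) := by
  have hp : p + 7 < 2 ^ W :=
    lt_of_lt_of_le (List.getElem?_eq_some_iff.1 (hmem 7 (by norm_num))).1 hf.length_le
  refine .load rfl h2 (hmem 0 (by norm_num)) ?_
  refine .add rfl h2 h4 (by omega) ?_
  refine .load rfl rfl (hmem 1 (by norm_num)) ?_
  refine .add rfl (a := p + 1) rfl h4 (by omega) ?_
  refine .load rfl rfl (hmem 2 (by norm_num)) ?_
  refine .add rfl (a := p + 2) rfl h4 (by omega) ?_
  refine .load rfl rfl (hmem 3 (by norm_num)) ?_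
  refine .add rfl (a := p + 3) rfl h4 (by omega) ?_
  refine .load rfl rfl (hmem 4 (by norm_num)) ?_
  refine .add rfl (a := p + 4) rfl h4 (by omega) ?_
  refine .load rfl rfl (hmem 5 (by norm_num)) ?_
  refine .add rfl (a := p + 5) rfl h4 (by omega) ?_
  refine .load rfl rfl (hmem 6 (by norm_num)) ?_
  refine .add rfl (a := p + 6) rfl h4 (by omega) ?_
  refine .load rfl rfl (hmem 7 (by norm_num)) ?_
  refine H _ (fun r hr => ?_) (fun c hc => ?_)
  · repeat rw [Function.update_of_ne (by omega)]
  · interval_cases c <;> rfl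

/-- The end of a step in a prefix: skip `z` positions, whose minimum has been taken into account
already. -/
theorem halts_prefix_skip {j o z : ℕ} (hf : Fits W mem v n) (h1 : ρ 1 = j) (h3 : ρ 3 = o)
    (h19 : ρ 19 = z) (hz : z ≤ j) (hj : o + j < n)
    (H : Halts W query mem Q 5 (Function.update (Function.update ρ 1 (j - z)) 3 (o + z)) T) :
    Halts W query mem Q 83 ρ (T + 3) := by
  have := hf.lt
  refine .sub rfl h1 h19 hz (by omega) ?_
  refine .add rfl h3 h19 (by omega) ?_
  exact .jump rfl H

/-- A step in a prefix: take the minimum of the first `z` positions into account, and skip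
them. -/
theorem halts_prefix_update {a j o z x m y k : ℕ} (hf : Fits W mem v n) (h1 : ρ 1 = j)
    (h3 : ρ 3 = o) (h5 : ρ 5 = 0) (h7 : ρ 7 = y) (h8 : ρ 8 = k) (h14 : ρ 14 = m)
    (h15 : ρ 15 = x) (h19 : ρ 19 = z) (hz : z ≤ j) (hj : o + j < n) (hb : Best v n a o y k)
    (hm : 0 < z → LeftmostMin v o (o + z) (o + x) ∧ v (o + x) = m)
    (H : ∀ ρ' y' k', (∀ r, r = 2 ∨ 4 ≤ r ∧ r ≤ 6 → ρ' r = ρ r) → ρ' 1 = j - z → ρ' 3 = o + z →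
      ρ' 7 = y' → ρ' 8 = k' → Best v n a (o + z) y' k' → Halts W query mem Q 5 ρ' T) :
    Halts W query mem Q 78 ρ (T + 9) := by
  have hlt := hf.lt
  rcases Nat.eq_zero_or_pos z with hz0 | hz0
  · refine .mono (T := T + 4) ?_ (by omega)
    refine .jumpEq_pos rfl h19 h5 hz0 ?_
    refine halts_prefix_skip hf h1 h3 h19 hz hj ?_
    refine H _ y k (fun r hr => ?_) rfl rfl h7 h8 (by simpa [hz0] using hb)
    repeat rw [Function.update_of_ne (by omega)]
  · obtain ⟨hm1, hm2⟩ := hm hz0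
    have hx : o + x < o + z := hm1.2.1
    refine .jumpEq_neg rfl h19 h5 (by omega) ?_
    by_cases hmy : m < y
    · refine .mono (T := T + 6) ?_ (by omega)
      refine .jumpLt_pos rfl h14 h7 hmy ?_
      refine .move rfl h14 ?_
      refine .add rfl h3 h15 (by omega) ?_
      refine halts_prefix_skip hf h1 h3 h19 hz hj ?_
      refine H _ m (o + x) (fun r hr => ?_) rfl rfl rfl rfl
        (hm2 ▸ hb.snoc_new hm1 (by omega))
      repeat rw [Function.update_of_ne (by omega)]
    · refine .mono (T := T + 5) ?_ (by omega)
      refine .jumpLt_neg rfl h14 h7 (by omega) ?_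
      refine .jump rfl ?_
      refine halts_prefix_skip hf h1 h3 h19 hz hj ?_
      refine H _ y k (fun r hr => ?_) rfl rfl h7 h8
        (hb.snoc_old hm1 (hf.val_lt _ (by omega)) (by omega))
      repeat rw [Function.update_of_ne (by omega)]

/-- The division of a position in the `t` copies of a first part of length `m`. -/
theorem exists_copy {i m t : ℕ} (hm : 0 < m) (hi : i < t * m) :
    ∃ q, q = i / m ∧ q < t ∧ q * m ≤ i ∧ i < q * m + m ∧ q * m + m ≤ t * m := by
  have h1 : i / m < t := (Nat.div_lt_iff_lt_mul hm).2 hi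
  have h2 : (i / m + 1) * m ≤ t * m := Nat.mul_le_mul_right _ h1
  rw [Nat.add_mul, one_mul] at h2
  exact ⟨_, rfl, h1, Nat.div_mul_le_self _ _, Nat.lt_div_mul_add hm, h2⟩

/-- The last phase: the positions `[a, o)` have been covered, and the query ends at the position `j`
of the current string. -/
theorem halts_prefix (hf : Fits W mem v n) {p o len r : ℕ} (hs : Stored mem v p o len r)
    (a : ℕ) : ∀ (ρ : ℕ → ℕ) (j y k : ℕ), ρ 1 = j → ρ 2 = p → ρ 3 = o → ρ 4 = 1 → ρ 5 = 0 →
      ρ 6 = 2 → ρ 7 = y → ρ 8 = k → j < len → o + len ≤ n → Best v n a o y k →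
      Halts W query mem (IsAnswer v a (o + j + 1)) 5 ρ (40 * (r + 1)) := by
  have hlt := hf.lt
  induction hs with
  | @leaf p o r f hmem h0 h4v =>
    intro ρ j y k h1 h2 h3 h4 h5 h6 h7 h8 hj hlen hb
    obtain rfl : j = 0 := by omega
    refine .mono (T := 25 + 15) (halts_load hf hmem h2 h4 fun ρ' hk hw => ?_) (by omega)
    rw [← hk _ (by norm_num)] at h1 h2 h3 h4 h5 h6 h7 h8
    have h10 : ρ' 10 = f 0 := hw 0 (by norm_num)
    have h14 : ρ' 14 = f 4 := hw 4 (by norm_num)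
    have hl := LeftmostMin.singleton v o
    have hk : v o < n := hf.val_lt o (by omega)
    refine .jumpEq_pos rfl h10 h5 h0 ?_
    refine .jumpEq_neg rfl h6 h4 (by norm_num) ?_
    refine .jumpLt_pos rfl h4 h6 (by norm_num) ?_
    by_cases hy : f 4 < y
    · refine .jumpLt_pos rfl h14 h7 hy ?_
      refine .move rfl h14 ?_
      refine .move rfl h3 ?_
      refine .add rfl (a := o) rfl h4 (by omega) ?_
      refine .halt rfl ⟨o, rfl, ?_⟩
      obtain ⟨rfl, h⟩ | ⟨h, -⟩ := hb.snoc_new hl (by omega)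
      · omega
      · exact h
    · refine .jumpLt_neg rfl h14 h7 (by omega) ?_
      refine .jump rfl ?_
      obtain ⟨rfl, h⟩ | ⟨h, -⟩ := hb.snoc_old hl hk (by omega)
      · omega
      have := h.2.1
      refine .add rfl h8 h4 (by omega) ?_
      exact .halt rfl ⟨k, rfl, h⟩
  | @node p o l r t f hmem h0 h1f hx hxm hy hym ihx ihy =>
    intro ρ j y k h1 h2 h3 h4 h5 h6 h7 h8 hj hlen hb
    refine .mono (T := 40 * (r + 1) + 25 + 15)
      (halts_load hf hmem h2 h4 fun ρ' hk hw => ?_) (by omega)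
    rw [← hk _ (by norm_num)] at h1 h2 h3 h4 h5 h6 h7 h8
    have h10 : ρ' 10 = f 0 := hw 0 (by norm_num)
    have h11 : ρ' 11 = t * f 0 := (hw 1 (by norm_num)).trans h1f
    have h12 : ρ' 12 = f 2 := hw 2 (by norm_num)
    have h13 : ρ' 13 = f 3 := hw 3 (by norm_num)
    have h14 : ρ' 14 = f 4 := hw 4 (by norm_num)
    have h15 : ρ' 15 = f 5 := hw 5 (by norm_num)
    refine .jumpEq_neg rfl h10 h5 (by omega) ?_
    refine .jumpEq_neg rfl h6 h4 (by norm_num) ?_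
    refine .jumpLt_pos rfl h4 h6 (by norm_num) ?_
    -- the minimum of the copies of the first part that precede the position `j`
    have hcopies : ∀ q ≤ t, 0 < q * f 0 →
        LeftmostMin v o (o + q * f 0) (o + f 5) ∧ v (o + f 5) = f 4 := by
      intro q hq hpos
      have hq0 : 0 < q := Nat.pos_of_mul_pos_right hpos
      have h := leftmostMin_copies (q := 0) (o := o) hq0 fun p hp => hxm p (by omega)
      have h' := (hxm 0 (by omega)).2
      simp only [zero_mul, add_zero] at h h'
      exact ⟨h, h'⟩
    by_cases hjt : j < t * f 0
    · obtain ⟨q, hq, hqt, hq1, hq2, hq3⟩ := exists_copy h0 hjt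
      refine .mono (T := 40 * (r + 1) + 9 + 4 + 3) ?_ (by omega)
      refine .jumpLt_pos rfl h1 h11 hjt ?_
      refine .div rfl h1 h10 ?_
      rw [← hq]
      refine .mul rfl (a := q) rfl h10 (by omega) ?_
      refine .move rfl h12 ?_
      refine .mono (halts_prefix_update hf h1 h3 h5 h7 h8 h14 h15 (z := q * f 0) rfl hq1
        (by omega) hb (hcopies q hqt.le) (T := 40 * (r + 1)) ?_) (by omega)
      intro ρ'' y' k' hk' g1 g3 g7 g8 hb'
      have := ihx q hqt ρ'' (j - q * f 0) y' k' g1 (hk' 2 (by omega)) g3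
        ((hk' 4 (by omega)).trans h4) ((hk' 5 (by omega)).trans h5) ((hk' 6 (by omega)).trans h6)
        g7 g8 (by omega) (by omega) hb'
      rwa [show o + q * f 0 + (j - q * f 0) + 1 = o + j + 1 by omega] at this
    · refine .mono (T := 40 * (r + 1) + 9 + 4) ?_ (by omega)
      refine .jumpLt_neg rfl h1 h11 (by omega) ?_
      refine .move rfl h11 ?_
      refine .move rfl h13 ?_
      refine .jump rfl ?_
      refine halts_prefix_update hf h1 h3 h5 h7 h8 h14 h15 (z := t * f 0) rfl (by omega)
        (by omega) hb
        (hcopies t le_rfl) (T := 40 * (r + 1)) ?_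
      intro ρ'' y' k' hk' g1 g3 g7 g8 hb'
      have := ihy ρ'' (j - t * f 0) y' k' g1 (hk' 2 (by omega)) g3
        ((hk' 4 (by omega)).trans h4) ((hk' 5 (by omega)).trans h5) ((hk' 6 (by omega)).trans h6)
        g7 g8 (by omega) (by omega) hb'
      rwa [show o + t * f 0 + (j - t * f 0) + 1 = o + j + 1 by omega] at this

/-- The end of a step in the first two phases: go to the copy of the first part that starts at `z`. -/
theorem halts_enter_copy {i o z p : ℕ} (hf : Fits W mem v n) (h0 : ρ 0 = i) (h3 : ρ 3 = o)
    (h12 : ρ 12 = p) (h19 : ρ 19 = z) (hz : z ≤ i) (hi : o + i < n)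
    (H : Halts W query mem Q 5 (Function.update (Function.update (Function.update ρ 0 (i - z))
      3 (o + z)) 2 p) T) : Halts W query mem Q 49 ρ (T + 4) := by
  have := hf.lt
  refine .sub rfl h0 h19 hz (by omega) ?_
  refine .add rfl h3 h19 (by omega) ?_
  refine .move rfl h12 ?_
  exact .jump rfl H

/-- The second phase: the query starts at the position `i` of the current string, the positions from
the end of that string up to `o'` have been covered, and the query ends at the position `j'` of the
string at `o'`, which is left to the last phase. -/
theorem halts_suffix (hf : Fits W mem v n) {p o len r p' o' len' r' j' : ℕ}
    (hs : Stored mem v p o len r) (hs' : Stored mem v p' o' len' r') (hj' : j' < len')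
    (ho' : o' + len' ≤ n) : ∀ (ρ : ℕ → ℕ) (i y k : ℕ), ρ 0 = i → ρ 2 = p → ρ 3 = o → ρ 4 = 1 →
      ρ 5 = 0 → ρ 6 = 1 → ρ 7 = y → ρ 8 = k → ρ 20 = o' → ρ 21 = p' → ρ 22 = j' → i < len →
      o + len ≤ n → Best v n (o + len) o' y k →
      Halts W query mem (IsAnswer v (o + i) (o' + j' + 1)) 5 ρ
        (40 * (r + 1) + 40 * (r' + 1)) := by
  have hlt := hf.lt
  induction hs with
  | @leaf p o r f hmem h0f h4v =>
    intro ρ i y k h0 h2 h3 h4 h5 h6 h7 h8 h20 h21 h22 hi hlen hb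
    obtain rfl : i = 0 := by omega
    refine .mono (T := 40 * (r' + 1) + 25 + 15)
      (halts_load hf hmem h2 h4 fun ρ' hk hw => ?_) (by omega)
    rw [← hk _ (by norm_num)] at h0 h2 h3 h4 h5 h6 h7 h8 h20 h21 h22
    have h10 : ρ' 10 = f 0 := hw 0 (by norm_num)
    have h14 : ρ' 14 = f 4 := hw 4 (by norm_num)
    have hl := LeftmostMin.singleton v o
    have hk : v o < n := hf.val_lt o (by omega)
    refine .jumpEq_pos rfl h10 h5 h0f ?_
    refine .jumpEq_pos rfl h6 h4 rfl ?_
    by_cases hy : y < f 4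
    · refine .mono (T := 40 * (r' + 1) + 6) ?_ (by omega)
      refine .jumpLt_pos rfl h7 h14 hy ?_
      refine .move rfl h21 ?_
      refine .move rfl h20 ?_
      refine .move rfl h22 ?_
      refine .add rfl h4 h4 (by omega) ?_
      refine .jump rfl ?_
      exact halts_prefix hf hs' o _ j' y k rfl rfl rfl h4 h5 rfl h7 h8 hj' ho'
        (hb.cons_old hl hk (by omega))
    · refine .mono (T := 40 * (r' + 1) + 8) ?_ (by omega)
      refine .jumpLt_neg rfl h7 h14 (by omega) ?_
      refine .move rfl h14 ?_
      refine .move rfl h3 ?_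
      refine .move rfl h21 ?_
      refine .move rfl h20 ?_
      refine .move rfl h22 ?_
      refine .add rfl h4 h4 (by omega) ?_
      refine .jump rfl ?_
      exact halts_prefix hf hs' o _ j' (v o) o rfl rfl rfl h4 h5 rfl h4v rfl hj' ho'
        (hb.cons_new hl (by omega))
  | @node p o l r t f hmem h0f h1f hx hxm hy hym ihx ihy =>
    intro ρ i y k h0 h2 h3 h4 h5 h6 h7 h8 h20 h21 h22 hi hlen hb
    refine .mono (T := 40 * (r + 1) + 40 * (r' + 1) + 25 + 15)
      (halts_load hf hmem h2 h4 fun ρ' hk hw => ?_) (by omega)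
    rw [← hk _ (by norm_num)] at h0 h2 h3 h4 h5 h6 h7 h8 h20 h21 h22
    have h10 : ρ' 10 = f 0 := hw 0 (by norm_num)
    have h11 : ρ' 11 = t * f 0 := (hw 1 (by norm_num)).trans h1f
    have h12 : ρ' 12 = f 2 := hw 2 (by norm_num)
    have h13 : ρ' 13 = f 3 := hw 3 (by norm_num)
    have h14 : ρ' 14 = f 4 := hw 4 (by norm_num)
    have h15 : ρ' 15 = f 5 := hw 5 (by norm_num)
    have h16 : ρ' 16 = f 6 := hw 6 (by norm_num)
    have h17 : ρ' 17 = f 7 := hw 7 (by norm_num)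
    refine .jumpEq_neg rfl h10 h5 (by omega) ?_
    refine .jumpEq_pos rfl h6 h4 rfl ?_
    by_cases hit : i < t * f 0
    swap
    · refine .mono (T := 40 * (r + 1) + 40 * (r' + 1) + 5) ?_ (by omega)
      refine .jumpLt_neg rfl h0 h11 (by omega) ?_
      refine .add rfl h3 h11 (by omega) ?_
      refine .sub rfl h0 h11 (by omega) (by omega) ?_
      refine .move rfl h13 ?_
      refine .jump rfl ?_
      rw [show o + i = o + t * f 0 + (i - t * f 0) by omega]
      rw [← add_assoc] at hb
      exact ihy _ (i - t * f 0) y k rfl rfl rfl h4 h5 h6 h7 h8 h20 h21 h22 (by omega) (by omega) hb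
    obtain ⟨q, hq, hqt, hq1, hq2, hq3⟩ := exists_copy h0f hit
    obtain ⟨hym1, hym2⟩ := hym
    have hyx := hym1.2.1
    rw [← add_assoc] at hb
    -- enter the copy `q`, after the minima of the other parts have been taken into account
    have enter : ∀ (ρ : ℕ → ℕ) (y k : ℕ), ρ 0 = i → ρ 3 = o → ρ 4 = 1 → ρ 5 = 0 → ρ 6 = 1 →
        ρ 7 = y → ρ 8 = k → ρ 12 = f 2 → ρ 19 = q * f 0 → ρ 20 = o' → ρ 21 = p' → ρ 22 = j' →
        Best v n (o + q * f 0 + f 0) o' y k →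
        Halts W query mem (IsAnswer v (o + i) (o' + j' + 1)) 49 ρ
          (40 * (r + 1) + 40 * (r' + 1) + 4) := by
      intro ρ y k h0 h3 h4 h5 h6 h7 h8 h12 h19 h20 h21 h22 hb
      refine halts_enter_copy hf h0 h3 h12 h19 hq1 (by omega) ?_
      rw [show o + i = o + q * f 0 + (i - q * f 0) by omega]
      exact ihx q hqt _ (i - q * f 0) y k rfl rfl rfl h4 h5 h6 h7 h8 h20 h21 h22 (by omega)
        (by omega) hb
    -- take the minimum of the copies after the copy `q` into account
    have copies : ∀ (ρ : ℕ → ℕ) (y k : ℕ), ρ 0 = i → ρ 3 = o → ρ 4 = 1 → ρ 5 = 0 → ρ 6 = 1 →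
        ρ 7 = y → ρ 8 = k → ρ 10 = f 0 → ρ 11 = t * f 0 → ρ 12 = f 2 → ρ 14 = f 4 → ρ 15 = f 5 →
        ρ 20 = o' → ρ 21 = p' → ρ 22 = j' → Best v n (o + t * f 0) o' y k →
        Halts W query mem (IsAnswer v (o + i) (o' + j' + 1)) 62 ρ
          (40 * (r + 1) + 40 * (r' + 1) + 13) := by
      intro ρ y k h0 h3 h4 h5 h6 h7 h8 h10 h11 h12 h14 h15 h20 h21 h22 hb
      refine .div rfl h0 h10 ?_
      rw [← hq]
      refine .mul rfl (a := q) rfl h10 (by omega) ?_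
      refine .add rfl (a := q * f 0) rfl h10 (by omega) ?_
      by_cases hlast : q * f 0 + f 0 = t * f 0
      · refine .mono (T := 40 * (r + 1) + 40 * (r' + 1) + 5) ?_ (by omega)
        refine .jumpEq_pos rfl rfl h11 hlast ?_
        refine enter _ y k h0 h3 h4 h5 h6 h7 h8 h12 rfl h20 h21 h22 ?_
        rwa [add_assoc, hlast]
      refine .jumpEq_neg rfl rfl h11 hlast ?_
      have hqt' : q + 1 < t := by
        rcases Nat.lt_or_ge (q + 1) t with h | h
        · exact h
        · obtain rfl : t = q + 1 := by omega
          exact absurd (by ring) hlast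
      have hmin := leftmostMin_copies hqt' hxm
      rw [show o + (q + 1) * f 0 = o + q * f 0 + f 0 by ring] at hmin
      have hval : v (o + q * f 0 + f 0 + f 5) = f 4 := by
        rw [← (hxm (q + 1) hqt').2]
        congr 1
        ring
      have hlt' := hmin.2.1
      by_cases hy4 : y < f 4
      · refine .mono (T := 40 * (r + 1) + 40 * (r' + 1) + 5) ?_ (by omega)
        refine .jumpLt_pos rfl h7 h14 hy4 ?_
        exact enter _ y k h0 h3 h4 h5 h6 h7 h8 h12 rfl h20 h21 h22
          (hb.cons_old hmin (hf.val_lt _ (by omega)) (by omega))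
      · refine .mono (T := 40 * (r + 1) + 40 * (r' + 1) + 9) ?_ (by omega)
        refine .jumpLt_neg rfl h7 h14 (by omega) ?_
        refine .move rfl h14 ?_
        refine .add rfl h3 (b := q * f 0 + f 0) rfl (by omega) ?_
        refine .add rfl (a := o + (q * f 0 + f 0)) rfl h15 (by omega) ?_
        refine .jump rfl ?_
        refine enter _ (f 4) (o + (q * f 0 + f 0) + f 5) h0 h3 h4 h5 h6 rfl rfl h12 rfl h20 h21
          h22 ?_
        have := hb.cons_new hmin (by omega)
        rw [hval] at this
        rwa [← add_assoc o (q * f 0) (f 0)]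
    refine .jumpLt_pos rfl h0 h11 hit ?_
    by_cases hy6 : y < f 6
    · refine .mono (T := 40 * (r + 1) + 40 * (r' + 1) + 14) ?_ (by omega)
      refine .jumpLt_pos rfl h7 h16 hy6 ?_
      exact copies _ y k h0 h3 h4 h5 h6 h7 h8 h10 h11 h12 h14 h15 h20 h21 h22
        (hb.cons_old hym1 (hf.val_lt _ (by omega)) (by omega))
    · refine .mono (T := 40 * (r + 1) + 40 * (r' + 1) + 17) ?_ (by omega)
      refine .jumpLt_neg rfl h7 h16 (by omega) ?_
      refine .move rfl h16 ?_
      refine .add rfl h3 h11 (by omega) ?_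
      refine .add rfl (a := o + t * f 0) rfl h17 (by omega) ?_
      refine copies _ (f 6) (o + t * f 0 + f 7) h0 h3 h4 h5 h6 rfl rfl h10 h11 h12 h14 h15 h20
        h21 h22 ?_
      have := hb.cons_new hym1 (by omega)
      rwa [hym2] at this

/-- The first phase: the current string contains the whole query. At most two walks of height `r`
follow where the ends of the query separate. -/
theorem halts_descend (hf : Fits W mem v n) {p o len r : ℕ} (hs : Stored mem v p o len r) :
    ∀ (ρ : ℕ → ℕ) (i j : ℕ), ρ 0 = i → ρ 1 = j → ρ 2 = p → ρ 3 = o → ρ 4 = 1 → ρ 5 = 0 →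
      ρ 6 = 0 → ρ 7 = n → i ≤ j → j < len → o + len ≤ n →
      Halts W query mem (IsAnswer v (o + i) (o + j + 1)) 5 ρ (80 * (r + 1)) := by
  have hlt := hf.lt
  induction hs with
  | @leaf p o r f hmem h0f h4v =>
    intro ρ i j h0 h1 h2 h3 h4 h5 h6 h7 hij hj hlen
    obtain rfl : j = 0 := by omega
    obtain rfl : i = 0 := by omega
    refine .mono (T := 25 + 15) (halts_load hf hmem h2 h4 fun ρ' hk hw => ?_) (by omega)
    rw [← hk _ (by norm_num)] at h3 h4 h5 h6
    refine .jumpEq_pos rfl (hw 0 (by norm_num)) h5 h0f ?_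
    refine .jumpEq_neg rfl h6 h4 (by norm_num) ?_
    refine .jumpLt_neg rfl h4 h6 (by norm_num) ?_
    refine .add rfl h3 h4 (by omega) ?_
    exact .halt rfl ⟨o, rfl, .singleton v o⟩
  | @node p o l r t f hmem h0f h1f hx hxm hy hym ihx ihy =>
    intro ρ i j h0 h1 h2 h3 h4 h5 h6 h7 hij hj hlen
    refine .mono (T := 80 * (r + 1) + 25 + 15)
      (halts_load hf hmem h2 h4 fun ρ' hk hw => ?_) (by omega)
    rw [← hk _ (by norm_num)] at h0 h1 h2 h3 h4 h5 h6 h7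
    have h10 : ρ' 10 = f 0 := hw 0 (by norm_num)
    have h11 : ρ' 11 = t * f 0 := (hw 1 (by norm_num)).trans h1f
    have h12 : ρ' 12 = f 2 := hw 2 (by norm_num)
    have h13 : ρ' 13 = f 3 := hw 3 (by norm_num)
    have h14 : ρ' 14 = f 4 := hw 4 (by norm_num)
    have h15 : ρ' 15 = f 5 := hw 5 (by norm_num)
    refine .jumpEq_neg rfl h10 h5 (by omega) ?_
    refine .jumpEq_neg rfl h6 h4 (by norm_num) ?_
    refine .jumpLt_neg rfl h4 h6 (by norm_num) ?_
    by_cases hit : i < t * f 0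
    swap
    · refine .mono (T := 80 * (r + 1) + 6) ?_ (by omega)
      refine .jumpLt_neg rfl h0 h11 (by omega) ?_
      refine .add rfl h3 h11 (by omega) ?_
      refine .sub rfl h0 h11 (by omega) (by omega) ?_
      refine .sub rfl h1 h11 (by omega) (by omega) ?_
      refine .move rfl h13 ?_
      refine .jump rfl ?_
      rw [show o + i = o + t * f 0 + (i - t * f 0) by omega,
        show o + j = o + t * f 0 + (j - t * f 0) by omega]
      exact ihy _ (i - t * f 0) (j - t * f 0) rfl rfl rfl rfl h4 h5 h6 h7 (by omega) (by omega)
        (by omega)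
    obtain ⟨q, hq, hqt, hq1, hq2, hq3⟩ := exists_copy h0f hit
    -- the ends of the query are in the copy `q` and in a later part, which starts at `q' * f 0`
    have split : ∀ (ρ : ℕ → ℕ) (q' p' l' : ℕ), ρ 0 = i → ρ 1 = j → ρ 3 = o → ρ 4 = 1 →
        ρ 5 = 0 → ρ 7 = n → ρ 10 = f 0 → ρ 12 = f 2 → ρ 14 = f 4 → ρ 15 = f 5 → ρ 19 = q * f 0 →
        ρ 20 = q' * f 0 → ρ 21 = p' → Stored mem v p' (o + q' * f 0) l' r → q < q' → q' ≤ t →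
        q' * f 0 ≤ j → j < q' * f 0 + l' → q' * f 0 + l' ≤ t * f 0 + l →
        Halts W query mem (IsAnswer v (o + i) (o + j + 1)) 39 ρ (80 * (r + 1) + 13) := by
      intro ρ q' p' l' h0 h1 h3 h4 h5 h7 h10 h12 h14 h15 h19 h20 h21 hs' hqq' hqt' hj1 hj2 hl'
      have hqq : (q + 1) * f 0 ≤ q' * f 0 := Nat.mul_le_mul_right _ hqq'
      rw [Nat.add_mul, one_mul] at hqq
      -- the minimum of the parts in between is known; go on with the two ends
      have ends : ∀ (ρ : ℕ → ℕ) (y k : ℕ), ρ 0 = i → ρ 1 = j → ρ 3 = o → ρ 4 = 1 → ρ 5 = 0 →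
          ρ 7 = y → ρ 8 = k → ρ 12 = f 2 → ρ 19 = q * f 0 → ρ 20 = q' * f 0 → ρ 21 = p' →
          Best v n (o + q * f 0 + f 0) (o + q' * f 0) y k →
          Halts W query mem (IsAnswer v (o + i) (o + j + 1)) 44 ρ (80 * (r + 1) + 8) := by
        intro ρ y k h0 h1 h3 h4 h5 h7 h8 h12 h19 h20 h21 hb
        refine .sub rfl h1 h20 hj1 (by omega) ?_
        refine .add rfl h3 h20 (by omega) ?_
        refine .move rfl h4 ?_
        refine .jump rfl ?_
        refine halts_enter_copy hf h0 h3 h12 h19 hq1 (by omega) ?_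
        have := halts_suffix hf (hx q hqt) hs' (j' := j - q' * f 0) (by omega) (by omega)
          (Function.update (Function.update (Function.update (Function.update (Function.update
            (Function.update ρ 22 (j - q' * f 0)) 20 (o + q' * f 0)) 6 1) 0 (i - q * f 0))
            3 (o + q * f 0)) 2 (f 2)) (i - q * f 0) y k rfl rfl rfl h4 h5 rfl h7 h8 rfl h21 rfl
          (by omega) (by omega) hb
        rw [show o + q * f 0 + (i - q * f 0) = o + i by omega,
          show o + q' * f 0 + (j - q' * f 0) = o + j by omega] at this
        exact this.mono (by omega)
      refine .add rfl h19 h10 (by omega) ?_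
      by_cases hadj : q * f 0 + f 0 = q' * f 0
      · refine .mono (T := 80 * (r + 1) + 9) ?_ (by omega)
        refine .jumpEq_pos rfl rfl h20 hadj ?_
        refine ends _ n _ h0 h1 h3 h4 h5 h7 rfl h12 h19 h20 h21 (Or.inl ⟨?_, rfl⟩)
        rw [add_assoc, hadj]
      · refine .jumpEq_neg rfl rfl h20 hadj ?_
        have hqt' : q + 1 < q' := by
          rcases Nat.lt_or_ge (q + 1) q' with h | h
          · exact h
          · obtain rfl : q' = q + 1 := by omega
            exact absurd (by ring) hadj
        have hmin := leftmostMin_copies hqt' fun p hp => hxm p (by omega)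
        rw [show o + (q + 1) * f 0 = o + (q * f 0 + f 0) by ring] at hmin
        have hval : v (o + (q * f 0 + f 0) + f 5) = f 4 := by
          rw [← (hxm (q + 1) (by omega)).2]
          congr 1
          ring
        have hlt' := hmin.2.1
        refine .move rfl h14 ?_
        refine .add rfl h3 (b := q * f 0 + f 0) rfl (by omega) ?_
        refine .add rfl (a := o + (q * f 0 + f 0)) rfl h15 (by omega) ?_
        refine ends _ (f 4) (o + (q * f 0 + f 0) + f 5) h0 h1 h3 h4 h5 rfl rfl h12 h19 h20 h21 ?_
        rw [add_assoc o]
        exact Or.inr ⟨hmin, hval.symm⟩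
    refine .jumpLt_pos rfl h0 h11 hit ?_
    refine .div rfl h0 h10 ?_
    rw [← hq]
    refine .mul rfl (a := q) rfl h10 (by omega) ?_
    by_cases hjt : j < t * f 0
    swap
    · refine .mono (T := 80 * (r + 1) + 13 + 4) ?_ (by omega)
      refine .jumpLt_neg rfl h1 h11 (by omega) ?_
      refine .move rfl h11 ?_
      refine .move rfl h13 ?_
      refine .jump rfl ?_
      exact split _ t (f 3) l h0 h1 h3 h4 h5 h7 h10 h12 h14 h15 rfl rfl rfl hy hqt le_rfl
        (by omega) hj le_rfl
    obtain ⟨q', hq', hqt', hq1', hq2', hq3'⟩ := exists_copy h0f hjt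
    refine .mono (T := 80 * (r + 1) + 13 + 5) ?_ (by omega)
    refine .jumpLt_pos rfl h1 h11 hjt ?_
    refine .div rfl h1 h10 ?_
    rw [← hq']
    have hqq' : q ≤ q' := by
      rw [hq, hq']
      exact Nat.div_le_div_right hij
    rcases hqq'.eq_or_lt with rfl | hqq'
    · refine .mono (T := 80 * (r + 1) + 4 + 2) ?_ (by omega)
      refine .jumpEq_pos rfl rfl rfl rfl ?_
      refine .sub rfl h1 rfl hq1' (by omega) ?_
      refine halts_enter_copy hf h0 h3 h12 rfl hq1 (by omega) ?_
      rw [show o + i = o + q * f 0 + (i - q * f 0) by omega,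
        show o + j = o + q * f 0 + (j - q * f 0) by omega]
      exact ihx q hqt _ (i - q * f 0) (j - q * f 0) rfl rfl rfl rfl h4 h5 h6 h7 (by omega)
        (by omega) (by omega)
    · refine .jumpEq_neg rfl rfl rfl hqq'.ne ?_
      refine .mul rfl (a := q') rfl h10 (by omega) ?_
      refine .move rfl h12 ?_
      exact split _ q' (f 2) (f 0) h0 h1 h3 h4 h5 h7 h10 h12 h14 h15 rfl rfl rfl (hx q' hqt')
        hqq' hqt'.le hq1' hq2' (by omega)

/-- The query program is correct on a memory that stores the whole string. -/
theorem answers_query (hf : Fits W mem v n) {p r i j : ℕ} (hp : mem[0]? = some p)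
    (hn : mem[1]? = some n) (hs : Stored mem v p 0 n r) (hi : 1 ≤ i) (hij : i ≤ j) (hj : j ≤ n) :
    ∃ k, LeftmostMin v (i - 1) j k ∧
      Answers W query mem i j (k + 1) (80 * (r + 1) + 5) := by
  have hlt := hf.lt
  have main : Halts W query mem (IsAnswer v (i - 1) j) 0
      (fun r => if r = 0 then i else if r = 1 then j else 0) (80 * (r + 1) + 5) := by
    refine .const rfl (by omega) ?_
    refine .sub rfl (a := i) (b := 1) rfl rfl hi (by omega) ?_
    refine .sub rfl (a := j) (b := 1) rfl rfl (by omega) (by omega) ?_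
    refine .load rfl (a := 0) rfl hp ?_
    refine .load rfl (a := 1) rfl hn ?_
    have := halts_descend hf hs (Function.update (Function.update (Function.update
      (Function.update (Function.update (fun r => if r = 0 then i else if r = 1 then j else 0) 4 1)
      0 (i - 1)) 1 (j - 1)) 2 p) 7 n) (i - 1) (j - 1) rfl rfl rfl rfl rfl rfl rfl rfl (by omega)
      (by omega) (by omega)
    rwa [show 0 + (i - 1) = i - 1 by omega, show 0 + (j - 1) + 1 = j by omega] at this
  obtain ⟨t, ht, s, hs1, hs2, ⟨k, hk, hmin⟩, hs4⟩ := main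
  exact ⟨k, hmin, t, ht, s, hs1, hs2, hk, hs4⟩

end RangeMin

namespace RangeMin

open BalancedRLSLP

variable {α : Type*}

/-! ### The index -/

theorem LeftmostMin.shift {u v : ℕ → ℕ} {o l k : ℕ} (h : LeftmostMin u 0 l k)
    (huv : ∀ q < l, u q = v (o + q)) : LeftmostMin v o (o + l) (o + k) := by
  obtain ⟨-, h2, h3⟩ := h
  refine ⟨by omega, by omega, fun m hm hm' => ?_⟩
  have := h3 (m - o) (by omega) (by omega)
  rw [huv _ h2, huv _ (by omega), show o + (m - o) = m by omega] at this
  exact ⟨this.1, fun h => this.2 (by omega)⟩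

theorem isPrefix_drop_of_append {w x y : List α} {o : ℕ} (h : x ++ y <+: w.drop o) :
    x <+: w.drop o ∧ y <+: w.drop (o + x.length) := by
  obtain ⟨z, hz⟩ := h
  refine ⟨⟨y ++ z, by rw [← hz, List.append_assoc]⟩, ⟨z, ?_⟩⟩
  rw [← List.drop_drop, ← hz, List.append_assoc, List.drop_left]

theorem isPrefix_drop_of_replicate {w x : List α} {o t q : ℕ} (hq : q < t)
    (h : (List.replicate t x).flatten <+: w.drop o) : x <+: w.drop (o + q * x.length) := by
  obtain ⟨d, rfl⟩ : ∃ d, t = q + (1 + d) := ⟨t - q - 1, by omega⟩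
  rw [List.replicate_add, List.flatten_append] at h
  have h1 := (isPrefix_drop_of_append h).2
  rw [List.replicate_add, List.flatten_append] at h1
  simpa using (isPrefix_drop_of_append h1).1

/-- The values `f a` of the symbols of a string, as a function of the position. -/
def values (f : α → ℕ) (s : List α) (q : ℕ) : ℕ :=
  (s.map f).getD q 0

theorem values_eq_of_isPrefix {f : α → ℕ} {w s : List α} {o q : ℕ} (h : s <+: w.drop o)
    (hq : q < s.length) : values f s q = values f w (o + q) := by
  obtain ⟨z, hz⟩ := h
  rw [values, values, List.getD_eq_getElem?_getD, List.getD_eq_getElem?_getD, ← List.getElem?_drop,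
    ← List.map_drop, ← hz, List.map_append, List.getElem?_append_left (by simpa using hq)]

theorem values_eq {f : α → ℕ} {w : List α} {q : ℕ} {a : α} (h : w[q]? = some a) :
    values f w q = f a := by
  simp [values, h]

/-- Memory words for the strings of a balanced set, such that the strings are stored. -/
theorem exists_memory (f : α → ℕ) {w : List α} {S : Finset (List α)} {ρ : List α → ℕ}
    (h : IsBalanced w S ρ) (hf : ∀ a ∈ w, f a < w.length) :
    ∃ mem : List ℕ, mem.length = 2 + 8 * S.card ∧
      (∀ x ∈ mem, x < 2 + 8 * S.card ∨ x ≤ w.length) ∧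
      ∃ p, mem[0]? = some p ∧ mem[1]? = some w.length ∧
        Stored mem (values f w) p 0 w.length (ρ w) := by
  classical
  have hsplit : ∀ s, ∃ x y t, s ∈ S → s.length = 1 ∨ (x ∈ S ∧ y ∈ S ∧ 1 ≤ t ∧
      s = (List.replicate t x).flatten ++ y ∧ ρ x < ρ s ∧ ρ y < ρ s) := by
    intro s
    by_cases hs : s ∈ S
    · obtain ⟨a, rfl⟩ | ⟨x, hx, y, hy, t, ht⟩ := h.split s hs
      · exact ⟨[], [], 0, fun _ => Or.inl rfl⟩
      · exact ⟨x, y, t, fun _ => Or.inr ⟨hx, hy, ht⟩⟩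
    · exact ⟨[], [], 0, fun h => absurd h hs⟩
  choose x y t hxyt using hsplit
  have hmin : ∀ s : List α, ∃ k, s ≠ [] → LeftmostMin (values f s) 0 s.length k := by
    intro s
    obtain ⟨k, hk⟩ := exists_leftmostMin (values f s) 0 (s.length - 1)
    refine ⟨k, fun hs => ?_⟩
    have := List.length_pos_of_ne_nil hs
    rwa [show 0 + (s.length - 1) + 1 = s.length by omega] at hk
  choose pos hpos using hmin
  let addr : List α → ℕ := fun s => 2 + 8 * S.toList.idxOf s
  have haddr : ∀ s ∈ S, addr s + 7 < 2 + 8 * S.card := by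
    intro s hs
    have : S.toList.idxOf s < S.toList.length :=
      List.idxOf_lt_length_iff.2 (Finset.mem_toList.2 hs)
    rw [Finset.length_toList] at this
    simp only [addr]
    omega
  let word : List α → ℕ → ℕ := fun s c =>
    if s.length = 1 then (if c = 4 then values f s 0 else 0) else
    [(x s).length, t s * (x s).length, addr (x s), addr (y s), values f (x s) (pos (x s)),
      pos (x s), values f (y s) (pos (y s)), pos (y s)].getD c 0
  let mem : List ℕ := (List.range (2 + 8 * S.card)).map fun i =>
    if i = 0 then addr w else if i = 1 then w.length else
    word (S.toList.getD ((i - 2) / 8) []) ((i - 2) % 8)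
  have hget : ∀ i < 2 + 8 * S.card, mem[i]? = some (if i = 0 then addr w else if i = 1 then w.length
      else word (S.toList.getD ((i - 2) / 8) []) ((i - 2) % 8)) := by
    intro i hi
    simp [mem, hi]
  have hword : ∀ s ∈ S, ∀ c < 8, mem[addr s + c]? = some (word s c) := by
    intro s hs c hc
    have h1 := haddr s hs
    rw [hget _ (by omega), if_neg (by simp only [addr]; omega), if_neg (by simp only [addr]; omega)]
    have h2 : (addr s + c - 2) / 8 = S.toList.idxOf s := by simp only [addr]; omega
    have h3 : (addr s + c - 2) % 8 = c := by simp only [addr]; omega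
    have h4 : S.toList.idxOf s < S.toList.length :=
      List.idxOf_lt_length_iff.2 (Finset.mem_toList.2 hs)
    rw [h2, h3, List.getD_eq_getElem _ _ h4, List.getElem_idxOf]
  have hlen : ∀ s ∈ S, s.length ≤ w.length := fun s hs => (h.isInfix s hs).length_le
  have hval : ∀ s ∈ S, ∀ q < s.length, values f s q < w.length := by
    intro s hs q hq
    rw [values_eq (List.getElem?_eq_getElem hq)]
    exact hf _ ((h.isInfix s hs).subset (List.getElem_mem hq))
  have hposlt : ∀ s ∈ S, pos s < s.length := fun s hs => (hpos s (h.ne_nil s hs)).2.1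
  refine ⟨mem, by simp [mem], ?_, addr w, ?_, ?_, ?_⟩
  · intro m hm
    obtain ⟨i, hi, rfl⟩ := List.mem_map.1 hm
    rw [List.mem_range] at hi
    split_ifs with h0 h1
    · have := haddr w h.mem
      omega
    · exact Or.inr le_rfl
    · have hi' : (i - 2) / 8 < S.toList.length := by rw [Finset.length_toList]; omega
      rw [List.getD_eq_getElem _ _ hi']
      have hs : S.toList[(i - 2) / 8] ∈ S := Finset.mem_toList.1 (List.getElem_mem hi')
      generalize S.toList[(i - 2) / 8] = s at hs
      have hc : (i - 2) % 8 < 8 := Nat.mod_lt _ (by norm_num)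
      generalize (i - 2) % 8 = c at hc
      simp only [word]
      split_ifs with h2 h3
      · exact Or.inr (hval s hs 0 (by omega)).le
      · omega
      · obtain h4 | ⟨hx, hy, ht, hs', -⟩ := hxyt s hs
        · exact absurd h4 h2
        have hl : s.length = t s * (x s).length + (y s).length := by
          conv_lhs => rw [hs']
          simp
        have := hlen s hs
        have := haddr _ hx
        have := haddr _ hy
        have := hlen _ hx
        have := hlen _ hy
        have := hposlt _ hx
        have := hposlt _ hy
        have := hval _ hx _ (hposlt _ hx)
        have := hval _ hy _ (hposlt _ hy)
        interval_cases c <;> simp only [List.getD_cons_zero, List.getD_cons_succ] <;> omega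
  · rw [hget 0 (by omega), if_pos rfl]
  · have := Finset.card_pos.2 ⟨w, h.mem⟩
    rw [hget 1 (by omega), if_neg (by norm_num), if_pos rfl]
  · have main : ∀ r, ∀ s ∈ S, ρ s ≤ r → ∀ o, s <+: w.drop o →
        Stored mem (values f w) (addr s) o s.length r := by
      intro r
      induction r with
      | zero =>
        intro s hs hr o ho
        obtain h1 | ⟨-, -, -, -, h2, -⟩ := hxyt s hs
        · rw [h1]
          refine .leaf (word s) (hword s hs) (by simp [word, h1]) ?_
          simpa [word, h1] using values_eq_of_isPrefix (f := f) (q := 0) ho (by omega)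
        · omega
      | succ r ih =>
        intro s hs hr o ho
        by_cases h1 : s.length = 1
        · rw [h1]
          refine .leaf (word s) (hword s hs) (by simp [word, h1]) ?_
          simpa [word, h1] using values_eq_of_isPrefix (f := f) (q := 0) ho (by omega)
        obtain h1' | ⟨hx, hy, ht, hs', hρx, hρy⟩ := hxyt s hs
        · exact absurd h1' h1
        rw [hs'] at ho
        obtain ⟨hox, hoy⟩ := isPrefix_drop_of_append ho
        have hl : (List.replicate (t s) (x s)).flatten.length = t s * (x s).length := by simp
        rw [hl] at hoy
        have hox' := fun q (hq : q < t s) => isPrefix_drop_of_replicate hq hox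
        have hlen' : s.length = t s * (x s).length + (y s).length := by
          conv_lhs => rw [hs']
          simp
        have hw : word s = fun c => [(x s).length, t s * (x s).length, addr (x s), addr (y s),
            values f (x s) (pos (x s)), pos (x s), values f (y s) (pos (y s)),
            pos (y s)].getD c 0 :=
          funext fun c => if_neg h1
        have hw0 : word s 0 = (x s).length := by rw [hw]; rfl
        rw [hlen', ← hw0]
        refine .node (word s) (hword s hs) ?_ ?_ ?_ ?_ ?_ ?_ (t := t s) <;> rw [hw] <;>
          simp only [List.getD_cons_zero, List.getD_cons_succ]
        · exact List.length_pos_of_ne_nil (h.ne_nil _ hx)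
        · exact fun q hq => ih _ hx (by omega) _ (hox' q hq)
        · intro q hq
          refine ⟨?_, (values_eq_of_isPrefix (hox' q hq) (hposlt _ hx)).symm⟩
          rw [Nat.add_mul, one_mul, ← add_assoc]
          exact (hpos _ (h.ne_nil _ hx)).shift fun q' hq' => values_eq_of_isPrefix (hox' q hq) hq'
        · exact ih _ hy (by omega) _ hoy
        · exact ⟨(hpos _ (h.ne_nil _ hy)).shift fun q' hq' => values_eq_of_isPrefix hoy hq',
            (values_eq_of_isPrefix hoy (hposlt _ hy)).symm⟩
    exact main _ w h.mem le_rfl 0 (by simp)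

/-- The symbols of a string can be replaced by numbers below its length. -/
theorem exists_ranks [LinearOrder α] (w : List α) :
    ∃ f : α → ℕ, (∀ a ∈ w, f a < w.length) ∧ ∀ a ∈ w, ∀ b ∈ w, f a < f b ↔ a < b := by
  classical
  have hmono : ∀ a ∈ w, ∀ b, a < b →
      (w.toFinset.filter (· < a)).card < (w.toFinset.filter (· < b)).card := by
    intro a ha b hab
    refine Finset.card_lt_card ((Finset.ssubset_iff_of_subset ?_).2 ⟨a, ?_, ?_⟩)
    · intro c hc
      rw [Finset.mem_filter] at hc ⊢
      exact ⟨hc.1, hc.2.trans hab⟩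
    · simp [ha, hab]
    · simp
  refine ⟨fun a => (w.toFinset.filter (· < a)).card, fun a ha => ?_, fun a ha b hb => ⟨?_, ?_⟩⟩
  · refine lt_of_lt_of_le (Finset.card_lt_card ?_) (List.toFinset_card_le w)
    exact (Finset.ssubset_iff_of_subset (Finset.filter_subset _ _)).2 ⟨a, by simp [ha], by simp⟩
  · intro hlt
    by_contra hab
    rcases (not_lt.1 hab).lt_or_eq with h | rfl
    · exact absurd (hmono b hb a h) hlt.not_gt
    · exact hlt.false
  · exact hmono a ha b

theorem LeftmostMin.isLeftmostMin [LinearOrder α] {w : List α} {f : α → ℕ}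
    (hf : ∀ a ∈ w, ∀ b ∈ w, f a < f b ↔ a < b) {i j k : ℕ} (hi : 1 ≤ i) (hj : j ≤ w.length)
    (h : LeftmostMin (values f w) (i - 1) j k) : IsLeftmostMin w i j (k + 1) := by
  obtain ⟨h1, h2, h3⟩ := h
  have hk : w[k]? = some w[k] := List.getElem?_eq_getElem (by omega)
  refine ⟨by omega, by omega, w[k], hk, fun m b hm hm' hb => ?_⟩
  have h4 := h3 (m - 1) (by omega) (by omega)
  rw [values_eq hk, values_eq hb] at h4
  have hb' := List.mem_of_getElem? hb
  have hk' : w[k] ∈ w := List.getElem_mem (by omega)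
  refine ⟨?_, fun hlt => (hf _ hk' _ hb').1 (h4.2 (by omega))⟩
  by_contra hcon
  have := (hf _ hb' _ hk').2 (not_le.1 hcon)
  omega

end RangeMin

theorem theorem3 :
    ∃ (P : WordRAM.Program) (C : ℕ),
      ∀ (α : Type*) [LinearOrder α] (w : List α), w ≠ [] →
        ∃ index : List ℕ,
          index.length ≤ C * grl w ∧
          ∀ W : ℕ, C * w.length ≤ 2 ^ W →
            (∀ x ∈ index, x < 2 ^ W) ∧
            ∀ i j : ℕ, 1 ≤ i → i ≤ j → j ≤ w.length →
              ∃ k : ℕ, IsLeftmostMin w i j k ∧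
                WordRAM.Answers W P index i j k (C * (Nat.log 2 w.length + 1)) := by
  -- a query takes at most `80 * (25 * log n + 5) + 5` steps
  refine ⟨RangeMin.query, 2100, fun α _ w hw => ?_⟩
  obtain ⟨S, ρ, hS, hcard, hρ⟩ := BalancedRLSLP.exists_isBalanced hw
  obtain ⟨f, hf, hf'⟩ := RangeMin.exists_ranks w
  obtain ⟨mem, hlen, hmem, p, hp, hn, hst⟩ := RangeMin.exists_memory f hS hf
  have hpos := List.length_pos_of_ne_nil hw
  have hgrl := RLSLP.grl_le w hw
  have hSpos := Finset.card_pos.2 ⟨w, hS.mem⟩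
  refine ⟨mem, by omega, fun W hW => ⟨fun x hx => ?_, fun i j hi hij hj => ?_⟩⟩
  · have := hmem x hx
    omega
  · have hfits : RangeMin.Fits W mem (RangeMin.values f w) w.length :=
      ⟨by omega, by omega, fun q hq => by
        rw [RangeMin.values_eq (List.getElem?_eq_getElem hq)]
        exact hf _ (List.getElem_mem hq)⟩
    obtain ⟨k, hk, t, ht, hs⟩ := RangeMin.answers_query hfits hp hn hst hi hij hj
    exact ⟨k + 1, hk.isLeftmostMin hf' hi hj, t, by omega, hs⟩
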